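/- An election $E=(C,V)$ consists of a set $C$ of $m$ candidates and a collection $V=(v_1,\dots,v_n)$ of voters, each of whom ranks all candidates from the most to the least desirable; $\mathrm{pos}_v(c)\in\{1,\dots,m\}$ denotes the position of $c$ in the ranking of $v$. The $\beta$-CC (Chamberlin--Courant) score of a committee $S\subseteq C$ is $\sum_{v\in V}\max_{c\in S}\,(m-\mathrm{pos}_v(c))$, i.e. each voter contributes the Borda score of his or her highest-ranked member of $S$. For a committee size $k$, $\beta\text{-}\mathrm{CC}(E,k)$ is the set of all size-$k$ subsets of $C$ with the highest $\beta$-CC score. In the problem $\beta$-CC \textsc{Robustness Radius} we are given an election $E$, a committee size $k$ and a nonnegative integer $B$, and we ask whether some election $E'$ with $\beta\text{-}\mathrm{CC}(E',k)\neq\beta\text{-}\mathrm{CC}(E,k)$ can be obtained from $E$ by at most $B$ swaps of adjacent candidates within the rankings of the voters. \textbf{Theorem.} $\beta$-CC \textsc{Robustness Radius} is in $\mathrm{FPT}$ when parameterized by the number $n$ of voters: there are a computable function $f\colon\mathbb{N}\to\mathbb{N}$, a constant $c$, and a single algorithm (a program of a random access machine with unit-cost addition and subtraction) that correctly decides every instance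 $I$ in at most $f(n)\cdot|I|^{c}$ steps, where $|I|$ is the length of the encoding of $I$ with all numbers written in binary. -/

import Mathlib

namespace RobustCC

/-! ### Elections and the Chamberlin--Courant rule -/

/-- An election with candidates `Fin m` and voters `Fin n`. The vote `E v` of voter `v` is a ranking:
`E v i` is the candidate at the `i`-th place (counted from `0`), from the most to the least
desirable one. -/
abbrev Election (m n : ℕ) : Type := Fin n → Equiv.Perm (Fin m)

/-- The position of candidate `c` in the vote of `v`; the top-ranked candidate has position `1`. -/
def pos {m n : ℕ} (E : Election m n) (v : Fin n) (c : Fin m) : ℕ := ((E v).symm c : ℕ) + 1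

/-- The Borda scoring function `β_m(i) = m - i`, applied to positions `1 ≤ i ≤ m` only. -/
def borda (m i : ℕ) : ℕ := m - i

/-- The score of committee `S` in the vote of `v`: the Borda score of the highest-ranked member of
`S`, that is, the largest Borda score of a member (the value for the empty committee is `0`). -/
def voteScore {m n : ℕ} (E : Election m n) (v : Fin n) (S : Finset (Fin m)) : ℕ :=
  S.sup fun c => borda m (pos E v c)

/-- The `β`-CC score of a committee. -/
def ccScore {m n : ℕ} (E : Election m n) (S : Finset (Fin m)) : ℕ :=
  ∑ v, voteScore E v S

/-- A multiwinner rule maps an election and a committee size to the set of winning committees. -/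
abbrev MultiwinnerRule : Type := ∀ m n : ℕ, Election m n → ℕ → Set (Finset (Fin m))

/-- The `β`-CC rule: the committees of size `k` with the highest `β`-CC score. -/
def betaCC : MultiwinnerRule := fun m _ E k =>
  {S : Finset (Fin m) | S.card = k ∧ ∀ T : Finset (Fin m), T.card = k → ccScore E T ≤ ccScore E S}

/-! ### The Robustness Radius problem -/

/-- `E'` is obtained from `E` by one swap of two adjacent candidates in one vote. -/
def AdjSwap {m n : ℕ} (E E' : Election m n) : Prop :=
  ∃ (v : Fin n) (i j : Fin m), (j : ℕ) = (i : ℕ) + 1 ∧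
    E' = Function.update E v ((Equiv.swap i j).trans (E v))

/-- `SwapReach B E E'`: the election `E'` is obtained from `E` by at most `B` adjacent swaps. -/
inductive SwapReach {m n : ℕ} : ℕ → Election m n → Election m n → Prop
  | refl (B : ℕ) (E : Election m n) : SwapReach B E E
  | step {B : ℕ} {E E' E'' : Election m n} :
      SwapReach B E E' → AdjSwap E' E'' → SwapReach (B + 1) E E''

/-- An instance of Robustness Radius: an election with `m` candidates and `n` voters, a committee
size `k` and a bound `B` on the number of swaps. -/
structure Instance where
  m : ℕ
  n : ℕ
  election : Election m n
  k : ℕ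
  B : ℕ

/-- The question of the Robustness Radius problem for the rule `R`. -/
def RobustnessRadius (R : MultiwinnerRule) (I : Instance) : Prop :=
  ∃ E' : Election I.m I.n, SwapReach I.B I.election E' ∧ R I.m I.n E' I.k ≠ R I.m I.n I.election I.k

/-- The encoding of an instance as a sequence of natural numbers: the number of voters, the number
of candidates, `k`, `B`, and then the votes one after the other, each as the list of its candidates
from the top to the bottom. -/
def Instance.encode (I : Instance) : List ℕ :=
  [I.n, I.m, I.k, I.B] ++
    (List.finRange I.n).flatMap fun v => List.ofFn fun i : Fin I.m => ((I.election v i : Fin I.m) : ℕ)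

/-! ### Random access machines

Programs of a random access machine on natural numbers, with variables and arrays (a program
mentions finitely many of them), and the operations addition, truncated subtraction, indirect
reading and indirect writing at unit cost. There is no multiplication, so that the number of bits
of a value grows by at most one per step and the running time is polynomially related to the
running time on a Turing machine. -/

/-- Expressions. -/
inductive Expr where
  | const (c : ℕ)
  | var (x : ℕ)
  | add (e₁ e₂ : Expr)
  | sub (e₁ e₂ : Expr)
  | read (a : ℕ) (e : Expr)

/-- Programs. -/
inductive Prog where
  | skip
  | assign (x : ℕ) (e : Expr)
  | write (a : ℕ) (e₁ e₂ : Expr)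
  | seq (p q : Prog)
  | ite (e : Expr) (p q : Prog)
  | loop (e : Expr) (p : Prog)

/-- A memory state: the values of the variables, and the contents of the arrays. -/
structure State where
  var : ℕ → ℕ
  arr : ℕ → ℕ → ℕ

/-- The value of an expression. -/
def Expr.eval (s : State) : Expr → ℕ
  | const c => c
  | var x => s.var x
  | add e₁ e₂ => e₁.eval s + e₂.eval s
  | sub e₁ e₂ => e₁.eval s - e₂.eval s
  | read a e => s.arr a (e.eval s)

/-- The number of steps for evaluating an expression: one for every operation in it. -/
def Expr.cost : Expr → ℕ
  | const _ => 1
  | var _ => 1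
  | add e₁ e₂ => e₁.cost + e₂.cost + 1
  | sub e₁ e₂ => e₁.cost + e₂.cost + 1
  | read _ e => e.cost + 1

/-- `s` with the variable `x` set to `a`. -/
def State.setVar (s : State) (x a : ℕ) : State :=
  { s with var := Function.update s.var x a }

/-- `s` with the cell `i` of the array `a` set to `b`. -/
def State.setArr (s : State) (a i b : ℕ) : State :=
  { s with arr := Function.update s.arr a (Function.update (s.arr a) i b) }

/-- `Runs p s s' t`: started in the state `s`, the program `p` stops in the state `s'` after exactly
`t` steps. Tests succeed on nonzero values. -/
inductive Runs : Prog → State → State → ℕ → Prop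
  | skip (s : State) : Runs .skip s s 1
  | assign (x : ℕ) (e : Expr) (s : State) :
      Runs (.assign x e) s (s.setVar x (e.eval s)) (e.cost + 1)
  | write (a : ℕ) (e₁ e₂ : Expr) (s : State) :
      Runs (.write a e₁ e₂) s (s.setArr a (e₁.eval s) (e₂.eval s)) (e₁.cost + e₂.cost + 1)
  | seq {p q : Prog} {s s' s'' : State} {t t' : ℕ} :
      Runs p s s' t → Runs q s' s'' t' → Runs (.seq p q) s s'' (t + t')
  | iteTrue {e : Expr} {p q : Prog} {s s' : State} {t : ℕ} :
      e.eval s ≠ 0 → Runs p s s' t → Runs (.ite e p q) s s' (e.cost + 1 + t)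
  | iteFalse {e : Expr} {p q : Prog} {s s' : State} {t : ℕ} :
      e.eval s = 0 → Runs q s s' t → Runs (.ite e p q) s s' (e.cost + 1 + t)
  | loopTrue {e : Expr} {p : Prog} {s s' s'' : State} {t t' : ℕ} :
      e.eval s ≠ 0 → Runs p s s' t → Runs (.loop e p) s' s'' t' →
        Runs (.loop e p) s s'' (e.cost + 1 + t + t')
  | loopFalse {e : Expr} {p : Prog} {s : State} :
      e.eval s = 0 → Runs (.loop e p) s s (e.cost + 1)

/-- Programs are deterministic. -/
theorem Runs.deterministic {p : Prog} {s s₁ s₂ : State} {t₁ t₂ : ℕ}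
    (h₁ : Runs p s s₁ t₁) (h₂ : Runs p s s₂ t₂) : s₁ = s₂ ∧ t₁ = t₂ := by
  induction h₁ generalizing s₂ t₂ with
  | skip | assign | write => cases h₂; exact ⟨rfl, rfl⟩
  | seq _ _ ih ih' =>
    cases h₂ with
    | seq g g' =>
      obtain ⟨rfl, rfl⟩ := ih g
      obtain ⟨rfl, rfl⟩ := ih' g'
      exact ⟨rfl, rfl⟩
  | iteTrue he _ ih =>
    cases h₂ with
    | iteTrue _ g => obtain ⟨rfl, rfl⟩ := ih g; exact ⟨rfl, rfl⟩
    | iteFalse h _ => exact absurd h he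
  | iteFalse he _ ih =>
    cases h₂ with
    | iteTrue h _ => exact absurd he h
    | iteFalse _ g => obtain ⟨rfl, rfl⟩ := ih g; exact ⟨rfl, rfl⟩
  | loopTrue he _ _ ih ih' =>
    cases h₂ with
    | loopTrue _ g g' =>
      obtain ⟨rfl, rfl⟩ := ih g
      obtain ⟨rfl, rfl⟩ := ih' g'
      exact ⟨rfl, rfl⟩
    | loopFalse h => exact absurd h he
  | loopFalse he =>
    cases h₂ with
    | loopTrue h _ _ => exact absurd he h
    | loopFalse _ => exact ⟨rfl, rfl⟩

/-- The initial state on the input `w`: the input stands in array `0`, its length in variable `0`,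
and everything else is zero. -/
def State.init (w : List ℕ) : State where
  var x := if x = 0 then w.length else 0
  arr a i := if a = 0 then w.getD i 0 else 0

/-- The length of the encoding of a sequence of natural numbers: all numbers are written in binary,
each followed by a separator. -/
def inputLength (w : List ℕ) : ℕ := (w.map fun x => Nat.size x + 1).sum

/-! ### Fixed-parameter tractability -/

/-- A parameterized decision problem on instances of type `α`. -/
structure ParamProblem (α : Type) where
  encode : α → List ℕ
  param : α → ℕ
  yes : α → Prop

/-- A parameterized problem is in FPT if one program decides it (the answer is in variable `0`:
`1` for yes and `0` for no) within `f(k) * |I|^c` steps, where `k` is the parameter and `|I|` the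
length of the encoding of the instance, for a computable function `f` and a constant `c`. -/
def ParamProblem.InFPT {α : Type} (P : ParamProblem α) : Prop :=
  ∃ (p : Prog) (f : ℕ → ℕ) (c : ℕ), Computable f ∧
    ∀ I : α, ∃ (s : State) (t : ℕ), Runs p (State.init (P.encode I)) s t ∧
      t ≤ f (P.param I) * inputLength (P.encode I) ^ c ∧
      (P.yes I → s.var 0 = 1) ∧ (¬ P.yes I → s.var 0 = 0)

/-- Robustness Radius for the rule `R`, parameterized by the number of voters. -/
def robustnessRadiusByVoters (R : MultiwinnerRule) : ParamProblem Instance where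
  encode := Instance.encode
  param := Instance.n
  yes := RobustnessRadius R

end RobustCC

/-!
Let the rank of a candidate in a vote be the number of candidates above it. The winning committees
are those of least cost, the sum over the voters of the rank of the best member.

If fewer than `k` candidates are on top of some vote, the winning committees are those that contain
all top candidates, so the question is whether `B` swaps can create a new top candidate or remove an
old one. Otherwise fix a winning committee `S`. Some committee `T` that lacks a member `s` of `S`
becomes at least as good as `S` by `B` swaps if and only if there are representatives of the voters
in `T` and a set `U` of votes, in which the representatives are below `S` and are swapped upwards
past its best member, such that the swaps in `U` cost at most `B` and the rank sum of the
representatives exceeds the cost of `S` by at most `B + |U|`: the swap with the best member of `S`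
gains two. A committee tied with `S` from the start is separated from it by one swap.

At most `n` voters are clustered by their representatives, and the members of `T` can be chosen for
each cluster separately. The algorithm tries all clusterings, all `U`, and all distributions of the
excess over the least rank sums of the clusters, which may be assumed to be at most `|U|`. These are
functions on `{0, …, n - 1}` with values at most `n`, so there are at most `(n + 1) ^ n` of
each kind.
-/

namespace RobustCC

open Finset Polynomial

/-! ### Programs that evaluate functions of the input -/

/-- Started in `s`, the program `p` stops within `T` steps in a state that satisfies `Q`. -/
def Ends (p : Prog) (s : State) (T : ℕ) (Q : State → Prop) : Prop :=
  ∃ s' t, Runs p s s' t ∧ t ≤ T ∧ Q s'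

section Ends

variable {p q : Prog} {s : State} {e : Expr} {x T T' : ℕ} {Q R : State → Prop}

theorem Ends.mono (h : Ends p s T R) (hT : T ≤ T') (hQ : ∀ s', R s' → Q s') : Ends p s T' Q := by
  obtain ⟨s', t, hr, ht, hs'⟩ := h
  exact ⟨s', t, hr, ht.trans hT, hQ _ hs'⟩

theorem Ends.seq (h : Ends p s T R) (h' : ∀ s', R s' → Ends q s' T' Q) :
    Ends (.seq p q) s (T + T') Q := by
  obtain ⟨s', t, hr, ht, hs'⟩ := h
  obtain ⟨s'', t', hr', ht', hs''⟩ := h' s' hs'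
  exact ⟨s'', _, hr.seq hr', Nat.add_le_add ht ht', hs''⟩

theorem Ends.assign (h : Q (s.setVar x (e.eval s))) : Ends (.assign x e) s (e.cost + 1) Q :=
  ⟨_, _, Runs.assign x e s, le_rfl, h⟩

theorem Ends.assign_seq (h : Ends q (s.setVar x (e.eval s)) T Q) :
    Ends (.seq (.assign x e) q) s (e.cost + 1 + T) Q :=
  (Ends.assign rfl).seq fun s' (hs' : _ = s') => hs' ▸ h

theorem Ends.ite (hp : e.eval s ≠ 0 → Ends p s T Q) (hq : e.eval s = 0 → Ends q s T' Q) :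
    Ends (.ite e p q) s (e.cost + 1 + (T + T')) Q := by
  by_cases he : e.eval s = 0
  · obtain ⟨s', t, hr, ht, hs'⟩ := hq he
    exact ⟨s', _, Runs.iteFalse he hr, by lia, hs'⟩
  · obtain ⟨s', t, hr, ht, hs'⟩ := hp he
    exact ⟨s', _, Runs.iteTrue he hr, by lia, hs'⟩

/-- The invariant `J` is indexed by the number of the remaining rounds. -/
theorem Ends.loop (J : ℕ → State → Prop) (h0 : ∀ s, J 0 s → e.eval s = 0)
    (h1 : ∀ r s, J (r + 1) s → e.eval s ≠ 0 ∧ Ends p s T (J r)) (r : ℕ) (h : J r s) :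
    Ends (.loop e p) s (r * (e.cost + 1 + T) + (e.cost + 1)) (J 0) := by
  induction r generalizing s with
  | zero => exact ⟨s, _, Runs.loopFalse (h0 s h), by lia, h⟩
  | succ r ih =>
    obtain ⟨he, s', t, hr, ht, hs'⟩ := h1 r s h
    obtain ⟨s'', t', hr', ht', hs''⟩ := ih hs'
    refine ⟨s'', _, Runs.loopTrue he hr hr', ?_, hs''⟩
    rw [Nat.succ_mul]
    lia

end Ends

theorem State.var_setVar (s : State) (x y a : ℕ) :
    (s.setVar x a).var y = if y = x then a else s.var y := by
  simp only [State.setVar, Function.update_apply]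

/-- The input, which the programs below only read. -/
abbrev State.input (s : State) : ℕ → ℕ := s.arr 0

/-- A bound on the number of rounds of all loops, kept in register `0`. -/
abbrev State.bound (s : State) : ℕ := s.var 0

/-- `s'` agrees with `s` on the arrays and on the registers `0, …, d`. -/
structure Agree (d : ℕ) (s s' : State) : Prop where
  arr : s'.arr = s.arr
  var : ∀ x ≤ d, s'.var x = s.var x

namespace Agree

variable {d e : ℕ} {s s' s'' : State}

theorem refl (d : ℕ) (s : State) : Agree d s s := ⟨rfl, fun _ _ => rfl⟩

theorem trans (h : Agree d s s') (h' : Agree d s' s'') : Agree d s s'' :=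
  ⟨h'.arr.trans h.arr, fun x hx => (h'.var x hx).trans (h.var x hx)⟩

theorem mono (h : Agree e s s') (hd : d ≤ e) : Agree d s s' :=
  ⟨h.arr, fun x hx => h.var x (hx.trans hd)⟩

theorem setVar (h : Agree d s s') {x : ℕ} (hx : d < x) (a : ℕ) : Agree d s (s'.setVar x a) :=
  ⟨h.arr, fun y hy => by rw [State.var_setVar, if_neg (by lia), h.var y hy]⟩

theorem input (h : Agree d s s') : s'.input = s.input := congrFun h.arr 0

theorem bound (h : Agree d s s') : s'.bound = s.bound := h.var 0 d.zero_le

end Agree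

/-- The function `f` of the state depends only on the arrays and the registers `0, …, d`, and for
each `e ≥ d` some program computes it into register `e + 1`, without changing the arrays and the
registers `0, …, e`. If the input and the bound satisfy `P`, the program runs in time polynomial in
the bound. -/
structure Evaluable (P : (ℕ → ℕ) → ℕ → Prop) (d : ℕ) (f : State → ℕ) : Prop where
  congr : ∀ {s s'}, Agree d s s' → f s' = f s
  exists_prog : ∀ e ≥ d, ∃ (p : Prog) (T : ℕ[X]), ∀ s, P s.input s.bound →
    Ends p s (T.eval s.bound) fun s' => Agree e s s' ∧ s'.var (e + 1) = f s

namespace Evaluable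

variable {P : (ℕ → ℕ) → ℕ → Prop} {d e : ℕ} {f g : State → ℕ}

theorem mono (hf : Evaluable P d f) (hd : d ≤ e) : Evaluable P e f :=
  ⟨fun h => hf.congr (h.mono hd), fun e' he => hf.exists_prog e' (hd.trans he)⟩

theorem of_eq (hf : Evaluable P d f) (hg : ∀ {s s'}, Agree d s s' → g s' = g s)
    (h : ∀ s, P s.input s.bound → f s = g s) : Evaluable P d g :=
  ⟨hg, fun e he =>
    let ⟨p, T, hp⟩ := hf.exists_prog e he
    ⟨p, T, fun s hs => h s hs ▸ hp s hs⟩⟩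

/-- An expression over the values of `f` and `g`, given by the registers in which they stand. -/
theorem map₂ (hf : Evaluable P d f) (hg : Evaluable P d g) (op : ℕ → ℕ → Expr) (F : ℕ → ℕ → ℕ)
    (hop : ∀ x y s, (op x y).eval s = F (s.var x) (s.var y))
    (hcost : ∀ x y, (op x y).cost = (op 0 0).cost) : Evaluable P d fun s => F (f s) (g s) := by
  refine ⟨fun h => by rw [hf.congr h, hg.congr h], fun e he => ?_⟩
  obtain ⟨p, T, hp⟩ := hf.exists_prog e he
  obtain ⟨q, T', hq⟩ := hg.exists_prog (e + 1) (by lia)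
  refine ⟨.seq p (.seq q (.assign (e + 1) (op (e + 1) (e + 2)))),
    T + (T' + C ((op 0 0).cost + 1)), fun s hs => ?_⟩
  simp only [eval_add, eval_C, ← hcost (e + 1) (e + 2)]
  refine (hp s hs).seq fun s₁ ⟨h₁, hv₁⟩ => ?_
  have hq₁ := hq s₁ (by rwa [h₁.input, h₁.bound])
  rw [h₁.bound] at hq₁
  refine hq₁.seq fun s₂ ⟨h₂, hv₂⟩ => Ends.assign ⟨?_, ?_⟩
  · exact (h₁.trans (h₂.mono (by lia))).setVar (by lia) _
  · rw [State.var_setVar, if_pos rfl, hop, h₂.var _ le_rfl, hv₁, hv₂, hg.congr (h₁.mono he)]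

theorem of_expr (E : Expr) (hE : ∀ {s s'}, Agree d s s' → E.eval s' = E.eval s) :
    Evaluable P d fun s => E.eval s := by
  refine ⟨hE, fun e he => ⟨.assign (e + 1) E, C (E.cost + 1), fun s _ => ?_⟩⟩
  rw [eval_C]
  exact Ends.assign ⟨(Agree.refl e s).setVar (by lia) _, by rw [State.var_setVar, if_pos rfl]⟩

theorem const (c : ℕ) : Evaluable P d fun _ => c := of_expr (.const c) fun _ => rfl

theorem reg {x : ℕ} (hx : x ≤ d) : Evaluable P d fun s => s.var x :=
  of_expr (.var x) fun h => h.var x hx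

theorem add (hf : Evaluable P d f) (hg : Evaluable P d g) : Evaluable P d fun s => f s + g s :=
  hf.map₂ hg (fun x y => .add (.var x) (.var y)) (· + ·) (fun _ _ _ => rfl) fun _ _ => rfl

theorem sub (hf : Evaluable P d f) (hg : Evaluable P d g) : Evaluable P d fun s => f s - g s :=
  hf.map₂ hg (fun x y => .sub (.var x) (.var y)) (· - ·) (fun _ _ _ => rfl) fun _ _ => rfl

theorem input (hf : Evaluable P d f) : Evaluable P d fun s => s.input (f s) := by
  refine ⟨fun h => by rw [h.input, hf.congr h], fun e he => ?_⟩
  obtain ⟨p, T, hp⟩ := hf.exists_prog e he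
  refine ⟨.seq p (.assign (e + 1) (.read 0 (.var (e + 1)))), T + C 3, fun s hs => ?_⟩
  simp only [eval_add, eval_C]
  refine (hp s hs).seq fun s' ⟨h, hv⟩ => Ends.assign ⟨h.setVar (by lia) _, ?_⟩
  rw [State.var_setVar, if_pos rfl, ← hv, ← h.input]
  rfl

/-- One round of a recursion with accumulator `e + 1`, round number `e + 2` and number of remaining
rounds `e + 3`, where `p` puts the new value of the accumulator into register `e + 4`. -/
def recRound (e : ℕ) (p : Prog) : Prog :=
  .seq p <| .seq (.assign (e + 1) (.var (e + 4))) <|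
    .seq (.assign (e + 2) (.add (.var (e + 2)) (.const 1)))
      (.assign (e + 3) (.sub (.var (e + 3)) (.const 1)))

/-- The loop invariant, with `r` remaining rounds, for the recursion that starts with `z` and has
`N` rounds with the step function `b`. -/
structure RecInvariant (e z N : ℕ) (b : ℕ → ℕ → ℕ) (s : State) (r : ℕ) (s' : State) : Prop where
  agree : Agree e s s'
  remaining : s'.var (e + 3) = r
  rounds : s'.var (e + 2) + r = N
  acc : s'.var (e + 1) = Nat.rec z b (s'.var (e + 2))

theorem RecInvariant.ends_recRound {z N r T : ℕ} {b : ℕ → ℕ → ℕ} {s s' : State} {p : Prog}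
    (h : RecInvariant e z N b s (r + 1) s') (hp : Ends p s' T fun s₁ =>
      Agree (e + 3) s' s₁ ∧ s₁.var (e + 4) = b (s'.var (e + 2)) (s'.var (e + 1))) :
    Ends (recRound e p) s' (T + 10) (RecInvariant e z N b s r) := by
  refine hp.seq fun s₁ ⟨h₁, hv⟩ => Ends.assign_seq (Ends.assign_seq (Ends.assign ?_))
  have h₂ := h₁.var (e + 2) (by lia)
  have h₃ := h₁.var (e + 3) (by lia)
  have hr := h.remaining
  have hN := h.rounds
  refine ⟨((h.agree.trans (h₁.mono (by lia))).setVar (by lia) _ |>.setVar (by lia) _).setVar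
    (by lia) _, ?_, ?_, ?_⟩ <;>
  simp only [State.var_setVar, Expr.eval, Nat.add_left_cancel_iff, Nat.reduceEqDiff, if_true,
    if_false, h₂, h₃]
  · lia
  · lia
  · rw [hv, h.acc]

theorem natRec {N z : State → ℕ} {b : State → ℕ → ℕ → ℕ} (hz : Evaluable P d z)
    (hN : Evaluable P d N) (hNb : ∀ s, P s.input s.bound → N s ≤ s.bound)
    (hb : ∀ e ≥ d, ∀ i a, Evaluable P e i → Evaluable P e a →
      Evaluable P e fun s => b s (i s) (a s)) :
    Evaluable P d fun s => Nat.rec (z s) (b s) (N s) := by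
  have hb_congr : ∀ {s s'}, Agree d s s' → b s' = b s := fun h =>
    funext₂ fun i a => (hb d le_rfl _ _ (const i) (const a)).congr h
  refine ⟨fun h => by rw [hb_congr h, hz.congr h, hN.congr h], fun e he => ?_⟩
  obtain ⟨pz, Tz, hpz⟩ := hz.exists_prog e he
  obtain ⟨pN, TN, hpN⟩ := hN.exists_prog (e + 1) (by lia)
  obtain ⟨pb, Tb, hpb⟩ := (hb (e + 3) (by lia) (fun s => s.var (e + 2)) (fun s => s.var (e + 1))
    (reg (by lia)) (reg (by lia))).exists_prog (e + 3) le_rfl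
  refine ⟨.seq pz <| .seq pN <| .seq (.assign (e + 3) (.var (e + 2))) <|
    .seq (.assign (e + 2) (.const 0)) (.loop (.var (e + 3)) (recRound e pb)),
    Tz + (TN + (4 + (X * (Tb + 12) + 2))), fun s hs => ?_⟩
  have round : ∀ r s', RecInvariant e (z s) (N s) (b s) s (r + 1) s' →
      (Expr.var (e + 3)).eval s' ≠ 0 ∧ Ends (recRound e pb) s' (Tb.eval s.bound + 10)
        (RecInvariant e (z s) (N s) (b s) s r) := fun r s' h => by
    have hpb' := hpb s' (by rwa [h.agree.input, h.agree.bound])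
    rw [h.agree.bound, hb_congr (h.agree.mono he)] at hpb'
    exact ⟨h.remaining.trans_ne r.succ_ne_zero, h.ends_recRound hpb'⟩
  simp only [eval_add, eval_mul, eval_X, eval_ofNat]
  refine (hpz s hs).seq fun s₁ ⟨h₁, hv₁⟩ => ?_
  have hpN₁ := hpN s₁ (by rwa [h₁.input, h₁.bound])
  rw [h₁.bound, hN.congr (h₁.mono he)] at hpN₁
  refine hpN₁.seq fun s₂ ⟨h₂, hv₂⟩ => ?_
  have start : RecInvariant e (z s) (N s) (b s) s (N s)
      ((s₂.setVar (e + 3) (s₂.var (e + 2))).setVar (e + 2) 0) := by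
    refine ⟨((h₁.trans (h₂.mono (by lia))).setVar (by lia) _).setVar (by lia) _, ?_, ?_, ?_⟩ <;>
    simp [State.var_setVar, hv₂, h₂.var, hv₁]
  refine ((Ends.loop _ (fun s' h => h.remaining) round _ start).assign_seq.assign_seq).mono ?_
    fun s' h => ⟨h.agree, ?_⟩
  · have := Nat.mul_le_mul_right (Tb.eval s.bound + 12) (hNb s hs)
    simp only [Expr.cost]
    lia
  · rw [h.acc, ← h.rounds, add_zero]

theorem sum {N : State → ℕ} {F : State → ℕ → ℕ} (hN : Evaluable P d N)
    (hNb : ∀ s, P s.input s.bound → N s ≤ s.bound)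
    (hF : ∀ e ≥ d, ∀ i, Evaluable P e i → Evaluable P e fun s => F s (i s)) :
    Evaluable P d fun s => ∑ i ∈ range (N s), F s i := by
  have h := natRec (const 0) hN hNb (b := fun s i a => a + F s i)
    fun e he i a hi ha => ha.add (hF e he i hi)
  have key : ∀ s, Nat.rec 0 (fun i a => a + F s i) (N s) = ∑ i ∈ range (N s), F s i := fun s => by
    induction N s with
    | zero => rfl
    | succ n ih => rw [sum_range_succ, ← ih]
  simpa only [key] using h

theorem mul (hf : Evaluable P d f) (hg : Evaluable P d g)
    (hgb : ∀ s, P s.input s.bound → g s ≤ s.bound) : Evaluable P d fun s => f s * g s := by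
  simpa only [sum_const, card_range, smul_eq_mul, mul_comm] using
    hg.sum hgb (F := fun s _ => f s) fun e he _ _ => hf.mono he

theorem pow (hf : Evaluable P d f) (hg : Evaluable P d g)
    (hfb : ∀ s, P s.input s.bound → f s ≤ s.bound)
    (hgb : ∀ s, P s.input s.bound → g s ≤ s.bound) : Evaluable P d fun s => f s ^ g s := by
  have h := natRec (const 1) hg hgb (b := fun s _ a => a * f s)
    fun e he _ a _ ha => ha.mul (hf.mono he) hfb
  have key : ∀ s, Nat.rec 1 (fun _ a => a * f s) (g s) = f s ^ g s := fun s => by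
    induction g s with
    | zero => rfl
    | succ n ih => rw [pow_succ, ← ih]
  simpa only [key] using h

theorem min (hf : Evaluable P d f) (hg : Evaluable P d g) :
    Evaluable P d fun s => Min.min (f s) (g s) := by
  simpa only [Nat.sub_sub_eq_min] using hf.sub (hf.sub hg)

end Evaluable

open Classical in
/-- The truth value of a proposition as a number. -/
noncomputable def truth (Q : Prop) : ℕ := if Q then 1 else 0

theorem truth_of {Q : Prop} (h : Q) : truth Q = 1 := if_pos h

theorem truth_of_not {Q : Prop} (h : ¬Q) : truth Q = 0 := if_neg h

theorem truth_eq_zero {Q : Prop} : truth Q = 0 ↔ ¬Q := by simp [truth]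

/-- The truth value of the predicate `Q` is evaluable. -/
abbrev EvaluablePred (P : (ℕ → ℕ) → ℕ → Prop) (d : ℕ) (Q : State → Prop) : Prop :=
  Evaluable P d fun s => truth (Q s)

namespace EvaluablePred

variable {P : (ℕ → ℕ) → ℕ → Prop} {d : ℕ} {f g N : State → ℕ} {Q R : State → Prop}

theorem congr (hQ : EvaluablePred P d Q) {s s' : State} (h : Agree d s s') : Q s' ↔ Q s := by
  have := Evaluable.congr hQ h
  rw [← not_iff_not, ← truth_eq_zero, ← truth_eq_zero, this]

theorem eq_zero (hf : Evaluable P d f) : EvaluablePred P d fun s => f s = 0 := by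
  have h : ∀ s, 1 - f s = truth (f s = 0) := fun s => by
    by_cases hs : f s = 0
    · rw [truth_of hs, hs]
    · rw [truth_of_not hs, Nat.sub_eq_zero_of_le (Nat.one_le_iff_ne_zero.2 hs)]
  simpa only [h] using (Evaluable.const 1).sub hf

theorem not (hQ : EvaluablePred P d Q) : EvaluablePred P d fun s => ¬Q s := by
  simpa only [truth_eq_zero] using eq_zero hQ

theorem ne_zero (hf : Evaluable P d f) : EvaluablePred P d fun s => f s ≠ 0 := (eq_zero hf).not

theorem or (hQ : EvaluablePred P d Q) (hR : EvaluablePred P d R) :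
    EvaluablePred P d fun s => Q s ∨ R s := by
  simpa only [ne_eq, Nat.add_eq_zero_iff, truth_eq_zero, not_and_or, not_not] using
    ne_zero (Evaluable.add hQ hR)

theorem and (hQ : EvaluablePred P d Q) (hR : EvaluablePred P d R) :
    EvaluablePred P d fun s => Q s ∧ R s := by
  simpa only [not_or, not_not] using (hQ.not.or hR.not).not

theorem imp (hQ : EvaluablePred P d Q) (hR : EvaluablePred P d R) :
    EvaluablePred P d fun s => Q s → R s := by
  simpa only [← imp_iff_not_or] using hQ.not.or hR

theorem le (hf : Evaluable P d f) (hg : Evaluable P d g) :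
    EvaluablePred P d fun s => f s ≤ g s := by
  simpa only [Nat.sub_eq_zero_iff_le] using eq_zero (hf.sub hg)

theorem lt (hf : Evaluable P d f) (hg : Evaluable P d g) :
    EvaluablePred P d fun s => f s < g s :=
  le (hf.add (.const 1)) hg

theorem eq (hf : Evaluable P d f) (hg : Evaluable P d g) :
    EvaluablePred P d fun s => f s = g s := by
  simpa only [← le_antisymm_iff] using (le hf hg).and (le hg hf)

theorem exists_lt {A : State → ℕ → Prop} (hN : Evaluable P d N)
    (hNb : ∀ s, P s.input s.bound → N s ≤ s.bound)
    (hA : ∀ e ≥ d, ∀ i, Evaluable P e i → EvaluablePred P e fun s => A s (i s)) :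
    EvaluablePred P d fun s => ∃ i < N s, A s i := by
  simpa only [ne_eq, sum_eq_zero_iff, mem_range, truth_eq_zero, not_forall, not_not,
    exists_prop] using ne_zero (hN.sum hNb (F := fun s i => truth (A s i)) hA)

theorem forall_lt {A : State → ℕ → Prop} (hN : Evaluable P d N)
    (hNb : ∀ s, P s.input s.bound → N s ≤ s.bound)
    (hA : ∀ e ≥ d, ∀ i, Evaluable P e i → EvaluablePred P e fun s => A s (i s)) :
    EvaluablePred P d fun s => ∀ i < N s, A s i := by
  simpa only [not_exists, not_and, not_not] using
    (exists_lt (A := fun s i => ¬A s i) hN hNb fun e he i hi => (hA e he i hi).not).not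

end EvaluablePred

namespace Evaluable

variable {P P' : (ℕ → ℕ) → ℕ → Prop} {d : ℕ} {f g N : State → ℕ} {Q : State → Prop}

open Classical in
theorem ite (hQ : EvaluablePred P d Q) (hf : Evaluable P' d f) (hg : Evaluable P d g)
    (h : ∀ s, P s.input s.bound → Q s → P' s.input s.bound) :
    Evaluable P d fun s => if Q s then f s else g s := by
  refine ⟨fun hs => by simp only [hQ.congr hs, hf.congr hs, hg.congr hs], fun e he => ?_⟩
  obtain ⟨p, T, hp⟩ := Evaluable.exists_prog hQ e he
  obtain ⟨q, T₁, hq⟩ := hf.exists_prog e he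
  obtain ⟨r, T₂, hr⟩ := hg.exists_prog e he
  refine ⟨.seq p (.ite (.var (e + 1)) q r), T + (2 + (T₁ + T₂)), fun s hs => ?_⟩
  simp only [eval_add, eval_ofNat]
  refine (hp s hs).seq fun s₁ ⟨h₁, hv⟩ => Ends.ite (fun hne => ?_) fun h0 => ?_
  · have hQs : Q s := not_not.1 fun hQs => hne (hv.trans (truth_of_not hQs))
    have hq₁ := hq s₁ (by rw [h₁.input, h₁.bound]; exact h s hs hQs)
    rw [h₁.bound] at hq₁
    refine hq₁.mono le_rfl fun s' ⟨h', hv'⟩ => ⟨h₁.trans h', ?_⟩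
    rw [hv', hf.congr (h₁.mono he), if_pos hQs]
  · have hQs : ¬Q s := truth_eq_zero.1 (hv.symm.trans h0)
    have hr₁ := hr s₁ (by rwa [h₁.input, h₁.bound])
    rw [h₁.bound] at hr₁
    refine hr₁.mono le_rfl fun s' ⟨h', hv'⟩ => ⟨h₁.trans h', ?_⟩
    rw [hv', hg.congr (h₁.mono he), if_neg hQs]

theorem sum_filter {F : State → ℕ → ℕ} {A : State → ℕ → Prop} [∀ s, DecidablePred (A s)]
    (hN : Evaluable P d N) (hNb : ∀ s, P s.input s.bound → N s ≤ s.bound)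
    (hA : ∀ e ≥ d, ∀ i, Evaluable P e i → EvaluablePred P e fun s => A s (i s))
    (hF : ∀ e ≥ d, ∀ i, Evaluable P e i → Evaluable P e fun s => F s (i s)) :
    Evaluable P d fun s => ∑ i ∈ range (N s) with A s i, F s i := by
  simp only [Finset.sum_filter]
  refine hN.sum hNb fun e he i hi => ?_
  convert (hA e he i hi).ite (hF e he i hi) (const 0) fun s hs _ => hs

theorem card_filter {A : State → ℕ → Prop} [∀ s, DecidablePred (A s)] (hN : Evaluable P d N)
    (hNb : ∀ s, P s.input s.bound → N s ≤ s.bound)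
    (hA : ∀ e ≥ d, ∀ i, Evaluable P e i → EvaluablePred P e fun s => A s (i s)) :
    Evaluable P d fun s => #{i ∈ range (N s) | A s i} := by
  simpa only [card_eq_sum_ones] using hN.sum_filter hNb hA fun _ _ _ _ => const 1

/-- On `[0, N)`, a nonempty set has exactly `sInf A` elements `r` below all its members. -/
theorem sInf {A : State → Set ℕ} (hN : Evaluable P d N)
    (hNb : ∀ s, P s.input s.bound → N s ≤ s.bound)
    (hA : ∀ e ≥ d, ∀ i, Evaluable P e i → EvaluablePred P e fun s => i s ∈ A s)
    (hAN : ∀ s, P s.input s.bound → ∀ i ∈ A s, i < N s) :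
    Evaluable P d fun s => InfSet.sInf (A s) := by
  classical
  have hcount := hN.card_filter (A := fun s r => (∃ i < N s, i ∈ A s) ∧ ∀ i < N s, i ∈ A s → r < i)
    hNb fun e he r hr => (EvaluablePred.exists_lt (hN.mono he) hNb
      fun e' he' => hA e' (he.trans he')).and
      (EvaluablePred.forall_lt (hN.mono he) hNb fun e' he' i hi =>
        (hA e' (he.trans he') i hi).imp (.lt (hr.mono he') hi))
  have hA_congr : ∀ {s s'}, Agree d s s' → A s' = A s := fun h =>
    Set.ext fun i => (hA d le_rfl _ (const i)).congr h
  refine hcount.of_eq (fun h => by rw [hA_congr h]) fun s hs => ?_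
  rcases (A s).eq_empty_or_nonempty with hs0 | hne
  · simp [hs0]
  · have hmem := Nat.sInf_mem hne
    have hlt := hAN s hs _ hmem
    rw [← card_range (InfSet.sInf (A s))]
    congr 1
    ext r
    simp only [mem_filter, mem_range]
    exact ⟨fun h => h.2.2 _ hlt hmem, fun h => ⟨h.trans hlt, ⟨_, hlt, hmem⟩,
      fun i _ hi => h.trans_le (Nat.sInf_le hi)⟩⟩

end Evaluable

theorem EvaluablePred.and_of {P P' : (ℕ → ℕ) → ℕ → Prop} {d : ℕ} {Q R : State → Prop}
    (hQ : EvaluablePred P d Q) (hR : EvaluablePred P' d R)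
    (h : ∀ s, P s.input s.bound → Q s → P' s.input s.bound) :
    EvaluablePred P d fun s => Q s ∧ R s := by
  classical
  have key : ∀ s, (if Q s then truth (R s) else 0) = truth (Q s ∧ R s) := fun s => by
    by_cases hs : Q s <;> simp [truth, hs]
  simpa only [key] using Evaluable.ite hQ hR (.const 0) h

/-! ### Fixed-parameter tractability of evaluable predicates -/

theorem eval_le_eval_of_le (p : ℕ[X]) {x y : ℕ} (h : x ≤ y) : p.eval x ≤ p.eval y := by
  simp only [eval_eq_sum_range]
  gcongr

theorem eval_le_eval_one_mul_pow (p : ℕ[X]) (x : ℕ) :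
    p.eval x ≤ p.eval 1 * (x + 1) ^ p.natDegree := by
  simp only [eval_eq_sum_range, one_pow, mul_one, Finset.sum_mul]
  refine Finset.sum_le_sum fun i hi => Nat.mul_le_mul_left _ ?_
  exact (Nat.pow_le_pow_left x.le_succ i).trans
    (Nat.pow_le_pow_right x.succ_pos (Nat.lt_succ_iff.1 (Finset.mem_range.1 hi)))

theorem EvaluablePred.exists_decision_prog {pre : (ℕ → ℕ) → ℕ → Prop} {g : ℕ → ℕ}
    {A : (ℕ → ℕ) → Prop} (hg : Evaluable (fun w b => w 0 < b) 0 fun s => g (s.input 0))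
    (hA : EvaluablePred pre 0 fun s => A s.input) : ∃ (p : Prog) (T : ℕ[X]), ∀ s,
      pre s.input (s.bound + s.input 0 + 1 + g (s.input 0)) →
      Ends p s (T.eval (s.bound + s.input 0 + 1 + g (s.input 0)))
        fun s' => s'.var 0 = truth (A s.input) := by
  obtain ⟨p, T, hp⟩ := hg.exists_prog 0 le_rfl
  obtain ⟨q, T', hq⟩ := Evaluable.exists_prog hA 0 le_rfl
  refine ⟨.seq (.assign 0 (.add (.add (.var 0) (.read 0 (.const 0))) (.const 1))) <| .seq p <|
    .seq (.assign 0 (.add (.var 0) (.var 1))) <| .seq q (.assign 0 (.var 1)),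
    7 + (T + (4 + (T' + 2))), fun s hs => ?_⟩
  have hp' := hp (s.setVar 0 (s.bound + s.input 0 + 1)) (by
    change s.input 0 < _
    rw [State.bound, State.var_setVar, if_pos rfl]
    lia)
  simp only [eval_add, eval_ofNat]
  refine Ends.assign_seq <| (hp'.mono (eval_le_eval_of_le T (Nat.le_add_right _ (g (s.input 0))))
    fun _ h => h).seq fun s₁ ⟨h₁, hv₁⟩ => Ends.assign_seq ?_
  have hbound : (Expr.add (.var 0) (.var 1)).eval s₁ =
      s.bound + s.input 0 + 1 + g (s.input 0) := by
    rw [Expr.eval, Expr.eval, Expr.eval, h₁.var 0 le_rfl, hv₁, State.var_setVar, if_pos rfl]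
    rfl
  have hinput : (s₁.setVar 0 ((Expr.add (.var 0) (.var 1)).eval s₁)).input = s.input := h₁.input
  have hq' := hq (s₁.setVar 0 ((Expr.add (.var 0) (.var 1)).eval s₁))
  rw [hinput, State.bound, State.var_setVar, if_pos rfl, hbound] at hq'
  rw [hbound]
  refine (hq' hs).seq fun s₂ ⟨_, hv₂⟩ => Ends.assign ?_
  rw [State.var_setVar, if_pos rfl]
  exact hv₂.trans (congrArg (fun w => truth (A w)) h₁.input)

theorem length_le_inputLength (w : List ℕ) : w.length ≤ inputLength w := by
  simpa only [inputLength, List.length_map] using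
    List.length_le_sum_of_one_le (w.map fun x => Nat.size x + 1) (by simp)

theorem inFPT_of_evaluablePred {α : Type} (P : ParamProblem α) {pre : (ℕ → ℕ) → ℕ → Prop}
    {g : ℕ → ℕ} {A : (ℕ → ℕ) → Prop} (hg : Primrec g)
    (hg' : Evaluable (fun w b => w 0 < b) 0 fun s => g (s.input 0))
    (hA : EvaluablePred pre 0 fun s => A s.input)
    (hne : ∀ I, P.encode I ≠ [])
    (hparam : ∀ I, (P.encode I).getD 0 0 = P.param I)
    (hpre : ∀ I b, (P.encode I).length + g (P.param I) ≤ b → pre ((P.encode I).getD · 0) b)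
    (hyes : ∀ I, A ((P.encode I).getD · 0) ↔ P.yes I) : P.InFPT := by
  obtain ⟨p, T, hp⟩ := hA.exists_decision_prog hg'
  refine ⟨p, fun n => T.eval 1 * (n + g n + 3) ^ T.natDegree, T.natDegree, ?_, fun I => ?_⟩
  · exact (Primrec.nat_mul.comp (.const _) ((Primrec₂.unpaired'.1 Nat.Primrec.pow).comp
      (Primrec.nat_add.comp (Primrec.nat_add.comp .id hg) (.const 3)) (.const _))).to_comp
  · have hbound := hp (State.init (P.encode I))
    change pre ((P.encode I).getD · 0) ((P.encode I).length + (P.encode I).getD 0 0 + 1 +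
      g ((P.encode I).getD 0 0)) → Ends p _ (T.eval ((P.encode I).length + (P.encode I).getD 0 0 +
      1 + g ((P.encode I).getD 0 0))) (fun s' => s'.var 0 = truth (A ((P.encode I).getD · 0)))
      at hbound
    rw [hparam, hyes] at hbound
    obtain ⟨s, t, hrun, ht, hs⟩ := hbound (hpre I _ (by lia))
    refine ⟨s, t, hrun, ht.trans ?_, fun h => hs.trans (truth_of h),
      fun h => hs.trans (truth_of_not h)⟩
    have hle := length_le_inputLength (P.encode I)
    have hpos := (List.length_pos_of_ne_nil (hne I)).trans_le hle
    calc T.eval ((P.encode I).length + P.param I + 1 + g (P.param I))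
      _ ≤ T.eval 1 * ((P.encode I).length + P.param I + 1 + g (P.param I) + 1) ^ T.natDegree :=
        eval_le_eval_one_mul_pow T _
      _ ≤ T.eval 1 * ((P.param I + g (P.param I) + 3) * inputLength (P.encode I)) ^
          T.natDegree := by
        gcongr
        nlinarith
      _ = _ := by rw [mul_pow, mul_assoc]

/-! ### Search over functions on the voters -/

/-- The functions `ℕ → ℕ` that are bounded by `n` and vanish from `n` on. The algorithm guesses
such functions on the voters `0, …, n - 1` and on the clusters `0, …, k - 1`, where `k ≤ n`. -/
def guesses (n : ℕ) : Set (ℕ → ℕ) := {φ | (∀ v, φ v ≤ n) ∧ ∀ v ≥ n, φ v = 0}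

/-- Guesses are enumerated by their base `n + 1` expansions. -/
theorem mem_guesses_iff {n : ℕ} {φ : ℕ → ℕ} : φ ∈ guesses n ↔
    ∃ g < (n + 1) ^ n, φ = fun v => g / (n + 1) ^ min v n % (n + 1) := by
  constructor
  · rintro ⟨hle, hzero⟩
    let g := finFunctionFinEquiv fun v : Fin n => (⟨φ v, Nat.lt_succ_of_le (hle v)⟩ : Fin (n + 1))
    refine ⟨g, g.isLt, funext fun v => ?_⟩
    rcases lt_or_ge v n with hv | hv
    · have h := congrArg Fin.val (congrFun (finFunctionFinEquiv.symm_apply_apply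
        fun v : Fin n => (⟨φ v, Nat.lt_succ_of_le (hle v)⟩ : Fin (n + 1))) ⟨v, hv⟩)
      rw [finFunctionFinEquiv_symm_apply_val] at h
      rw [min_eq_left hv.le]
      exact h.symm
    · rw [min_eq_right hv, Nat.div_eq_of_lt g.isLt, Nat.zero_mod, hzero v hv]
  · rintro ⟨g, hg, rfl⟩
    refine ⟨fun v => Nat.lt_succ_iff.1 (Nat.mod_lt _ n.succ_pos), fun v hv => ?_⟩
    simp only [min_eq_right hv, Nat.div_eq_of_lt hg, Nat.zero_mod]

namespace Evaluable

variable {P : (ℕ → ℕ) → ℕ → Prop} {d : ℕ} {f g : State → ℕ}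

theorem div (hf : Evaluable P d f) (hg : Evaluable P d g)
    (hfb : ∀ s, P s.input s.bound → f s ≤ s.bound) (hgb : ∀ s, P s.input s.bound → g s ≤ s.bound)
    (hg0 : ∀ s, P s.input s.bound → 0 < g s) : Evaluable P d fun s => f s / g s := by
  have h := hf.card_filter (A := fun s q => (q + 1) * g s ≤ f s) hfb fun e he q hq =>
    .le ((hq.add (const 1)).mul (hg.mono he) hgb) (hf.mono he)
  refine h.of_eq (fun hs => by rw [hf.congr hs, hg.congr hs]) fun s hs => ?_
  rw [← card_range (f s / g s)]
  congr 1
  ext q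
  simp only [mem_filter, mem_range, ← Nat.le_div_iff_mul_le (hg0 s hs), Nat.succ_le_iff]
  exact ⟨And.right, fun hq => ⟨hq.trans_le (Nat.div_le_self _ _), hq⟩⟩

theorem mod (hf : Evaluable P d f) (hg : Evaluable P d g)
    (hfb : ∀ s, P s.input s.bound → f s ≤ s.bound) (hgb : ∀ s, P s.input s.bound → g s ≤ s.bound)
    (hg0 : ∀ s, P s.input s.bound → 0 < g s) : Evaluable P d fun s => f s % g s := by
  simpa only [Nat.mod_eq_sub_div_mul] using hf.sub ((hf.div hg hfb hgb hg0).mul hg hgb)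

end Evaluable

/-- The function `φ`, which may depend on the input, can be evaluated at arguments that do. -/
def EvaluableFun (P : (ℕ → ℕ) → ℕ → Prop) (d : ℕ) (φ : State → ℕ → ℕ) : Prop :=
  ∀ e ≥ d, ∀ v, Evaluable P e v → Evaluable P e fun s => φ s (v s)

theorem EvaluableFun.mono {P : (ℕ → ℕ) → ℕ → Prop} {d e : ℕ} {φ : State → ℕ → ℕ}
    (hφ : EvaluableFun P d φ) (hd : d ≤ e) : EvaluableFun P e φ :=
  fun e' he => hφ e' (hd.trans he)

section Guesses

variable {P : (ℕ → ℕ) → ℕ → Prop} {d : ℕ} {n : State → ℕ}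

theorem Evaluable.pow_succ_self (hn : Evaluable P d n)
    (hnb : ∀ s, P s.input s.bound → n s < s.bound) : Evaluable P d fun s => (n s + 1) ^ n s :=
  (hn.add (.const 1)).pow hn hnb fun s hs => (hnb s hs).le

theorem EvaluablePred.exists_guess {A : State → (ℕ → ℕ) → Prop} (hn : Evaluable P d n)
    (hnb : ∀ s, P s.input s.bound → n s < s.bound)
    (hpow : ∀ s, P s.input s.bound → (n s + 1) ^ n s ≤ s.bound)
    (hA : ∀ e ≥ d, ∀ φ, EvaluableFun P e φ → EvaluablePred P e fun s => A s (φ s)) :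
    EvaluablePred P d fun s => ∃ φ ∈ guesses (n s), A s φ := by
  have h := EvaluablePred.exists_lt (A := fun s g => A s fun v =>
    min g ((n s + 1) ^ n s) / (n s + 1) ^ min v (n s) % (n s + 1))
    (hn.pow_succ_self hnb) hpow fun e he g hg => hA e he _ fun e' he' v hv => by
      have hn' := hn.mono (he.trans he')
      have hmin : ∀ s, P s.input s.bound → min (g s) ((n s + 1) ^ n s) ≤ s.bound :=
        fun s hs => (min_le_right _ _).trans (hpow s hs)
      have hpow' : ∀ s, P s.input s.bound → (n s + 1) ^ min (v s) (n s) ≤ s.bound :=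
        fun s hs => (Nat.pow_le_pow_right (n s).succ_pos (min_le_right _ _)).trans (hpow s hs)
      exact (((hg.mono he').min (hn'.pow_succ_self hnb)).div
        ((hn'.add (.const 1)).pow (hv.min hn') hnb fun s hs =>
          (min_le_right _ _).trans (hnb s hs).le) hmin hpow' fun s _ => by positivity).mod
        (hn'.add (.const 1)) (fun s hs => (Nat.div_le_self _ _).trans (hmin s hs)) hnb
        fun s _ => (n s).succ_pos
  have key : ∀ s, (∃ g < (n s + 1) ^ n s, A s fun v =>
      min g ((n s + 1) ^ n s) / (n s + 1) ^ min v (n s) % (n s + 1)) ↔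
      ∃ φ ∈ guesses (n s), A s φ := fun s => by
    simp only [mem_guesses_iff]
    constructor
    · rintro ⟨g, hg, hA⟩
      exact ⟨_, ⟨g, hg, rfl⟩, by rwa [min_eq_left hg.le] at hA⟩
    · rintro ⟨_, ⟨g, hg, rfl⟩, hA⟩
      exact ⟨g, hg, by rwa [min_eq_left hg.le]⟩
  simpa only [key] using h

end Guesses

/-! ### Adjacent swaps -/

section Vote

variable {m b : ℕ} {σ τ : Equiv.Perm (Fin m)} {S : Finset (Fin m)} {c : Fin m}

/-- The number of candidates above `c` in the vote `σ`. -/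
def rank (σ : Equiv.Perm (Fin m)) (c : Fin m) : ℕ := (σ.symm c : ℕ)

theorem rank_injective (σ : Equiv.Perm (Fin m)) : Function.Injective (rank σ) :=
  Fin.val_injective.comp σ.symm.injective

theorem rank_lt (σ : Equiv.Perm (Fin m)) (c : Fin m) : rank σ c < m := (σ.symm c).2

theorem exists_rank_eq (σ : Equiv.Perm (Fin m)) {r : ℕ} (hr : r < m) : ∃ c, rank σ c = r :=
  ⟨σ ⟨r, hr⟩, by rw [rank, Equiv.symm_apply_apply]⟩

/-- The rank of the best member of a committee in a vote, which is `0` for the empty committee. -/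
noncomputable def bestRank (σ : Equiv.Perm (Fin m)) (S : Finset (Fin m)) : ℕ :=
  sInf {r | ∃ c ∈ S, rank σ c = r}

theorem bestRank_le (hc : c ∈ S) : bestRank σ S ≤ rank σ c := Nat.sInf_le ⟨c, hc, rfl⟩

theorem exists_rank_eq_bestRank (σ : Equiv.Perm (Fin m)) (hS : S.Nonempty) :
    ∃ c ∈ S, rank σ c = bestRank σ S :=
  Nat.sInf_mem (s := {r | ∃ c ∈ S, rank σ c = r}) ⟨_, hS.choose, hS.choose_spec, rfl⟩

theorem le_bestRank {x : ℕ} (hS : S.Nonempty) (h : ∀ c ∈ S, x ≤ rank σ c) : x ≤ bestRank σ S := by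
  obtain ⟨c, hc, hbest⟩ := exists_rank_eq_bestRank σ hS
  exact hbest ▸ h c hc

theorem mem_of_rank_eq_bestRank (hS : S.Nonempty) (hc : rank σ c = bestRank σ S) : c ∈ S := by
  obtain ⟨d, hd, hbest⟩ := exists_rank_eq_bestRank σ hS
  exact rank_injective σ (hc.trans hbest.symm) ▸ hd

theorem bestRank_eq_zero_iff (hS : S.Nonempty) (hc : rank σ c = 0) : bestRank σ S = 0 ↔ c ∈ S :=
  ⟨fun h => mem_of_rank_eq_bestRank hS (hc.trans h.symm),
    fun h => Nat.le_zero.1 ((bestRank_le h).trans_eq hc)⟩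

/-- `VoteReach b σ τ`: the vote `τ` is obtained from `σ` by exactly `b` adjacent swaps. -/
inductive VoteReach : ℕ → Equiv.Perm (Fin m) → Equiv.Perm (Fin m) → Prop
  | refl (σ : Equiv.Perm (Fin m)) : VoteReach 0 σ σ
  | step {b : ℕ} {σ τ : Equiv.Perm (Fin m)} (i j : Fin m) (hij : (j : ℕ) = (i : ℕ) + 1) :
      VoteReach b σ τ → VoteReach (b + 1) σ ((Equiv.swap i j).trans τ)

theorem VoteReach.trans {a : ℕ} {ρ : Equiv.Perm (Fin m)} (h : VoteReach a σ τ)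
    (h' : VoteReach b τ ρ) : VoteReach (a + b) σ ρ := by
  induction h' with
  | refl => exact h
  | step i j hij _ ih => exact .step i j hij (ih h)

theorem VoteReach.eq_of_zero (h : VoteReach 0 σ τ) : τ = σ := by
  cases h
  rfl

theorem rank_swap (σ : Equiv.Perm (Fin m)) {i j : Fin m} (hij : (j : ℕ) = (i : ℕ) + 1)
    (c : Fin m) : rank ((Equiv.swap i j).trans σ) c =
      if rank σ c = i then (i : ℕ) + 1 else if rank σ c = i + 1 then (i : ℕ) else rank σ c := by
  simp only [rank, Equiv.symm_trans_apply, Equiv.symm_swap, Equiv.swap_apply_def, ← hij,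
    Fin.val_inj]
  split_ifs <;> simp only [hij]

theorem exists_raise {r : ℕ} (hc : rank σ c = r + 1) :
    ∃ τ, VoteReach 1 σ τ ∧ rank τ c = r ∧ ∀ d ≠ c, rank σ d ≤ rank τ d := by
  have hr : r + 1 < m := hc ▸ rank_lt σ c
  have hij : ((⟨r + 1, hr⟩ : Fin m) : ℕ) = ((⟨r, by omega⟩ : Fin m) : ℕ) + 1 := rfl
  refine ⟨_, .step _ _ hij (.refl σ), ?_, fun d hd => ?_⟩
  · rw [rank_swap σ hij, hc, if_neg (Nat.succ_ne_self r), if_pos rfl]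
  · have hne : rank σ d ≠ r + 1 := fun h => hd (rank_injective σ (h.trans hc.symm))
    rw [rank_swap σ hij, if_neg hne]
    split_ifs with h
    · exact h.trans_le (Nat.le_succ r)
    · exact le_rfl

theorem exists_raise_to {r : ℕ} (hc : rank σ c = r + b) :
    ∃ τ, VoteReach b σ τ ∧ rank τ c = r ∧ ∀ d ≠ c, r ≤ rank σ d → r < rank τ d := by
  induction b generalizing σ with
  | zero =>
    exact ⟨σ, .refl σ, hc, fun d hd h =>
      h.lt_of_ne fun heq => hd (rank_injective σ (heq.symm.trans hc.symm))⟩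
  | succ b ih =>
    obtain ⟨τ, hστ, hτ, hle⟩ := exists_raise (r := r + b) hc
    obtain ⟨ρ, hτρ, hρ, hlt⟩ := ih hτ
    exact ⟨ρ, Nat.add_comm 1 b ▸ hστ.trans hτρ, hρ, fun d hd h => hlt d hd (h.trans (hle d hd))⟩

theorem exists_overtake (hS : S.Nonempty) (hcS : c ∉ S) (hc : rank σ c = bestRank σ S + b) :
    ∃ τ, VoteReach b σ τ ∧ rank τ c < bestRank τ S := by
  obtain ⟨τ, hστ, hτ, hlt⟩ := exists_raise_to hc
  refine ⟨τ, hστ, ?_⟩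
  rw [hτ]
  exact le_bestRank hS fun d hd => hlt d (fun h => hcS (h ▸ hd)) (bestRank_le hd)

theorem VoteReach.rank_le (h : VoteReach b σ τ) (c : Fin m) : rank σ c ≤ rank τ c + b := by
  induction h with
  | refl => exact le_rfl
  | @step b σ τ i j hij _ ih =>
    rw [rank_swap τ hij]
    split_ifs <;> omega

theorem bestRank_swap (σ : Equiv.Perm (Fin m)) {i j : Fin m} (hij : (j : ℕ) = (i : ℕ) + 1)
    (hS : S.Nonempty) (c : Fin m) :
    bestRank ((Equiv.swap i j).trans σ) S + rank σ c ≤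
      bestRank σ S + rank ((Equiv.swap i j).trans σ) c + 1 ∨
    (c ∉ S ∧ rank σ c = bestRank σ S + 1 ∧
      bestRank ((Equiv.swap i j).trans σ) S = rank ((Equiv.swap i j).trans σ) c + 1) := by
  obtain ⟨d, hd, hbest⟩ := exists_rank_eq_bestRank σ hS
  have hle : bestRank ((Equiv.swap i j).trans σ) S ≤ rank ((Equiv.swap i j).trans σ) d :=
    bestRank_le hd
  have hd' := rank_swap σ hij d
  have hc' := rank_swap σ hij c
  by_cases hc : c ∈ S
  · have hleσ : bestRank σ S ≤ rank σ c := bestRank_le hc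
    have hleτ : bestRank ((Equiv.swap i j).trans σ) S ≤ rank ((Equiv.swap i j).trans σ) c :=
      bestRank_le hc
    left
    split_ifs at hd' hc' <;> omega
  · rw [or_iff_not_imp_left, not_le]
    intro hlt
    refine ⟨hc, ?_⟩
    split_ifs at hd' hc' <;> omega

/-- By `b` swaps, a candidate gains at most `b` on a committee, and `b + 1` if it overtakes it:
the swap of a candidate with the best member of the committee counts twice. -/
theorem VoteReach.gain_le (h : VoteReach b σ τ) (hS : S.Nonempty) (c : Fin m) :
    bestRank τ S + rank σ c ≤ bestRank σ S + rank τ c + b ∨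
    (c ∉ S ∧ bestRank σ S < rank σ c ∧ rank τ c < bestRank τ S ∧ rank σ c ≤ bestRank σ S + b ∧
      bestRank τ S + rank σ c ≤ bestRank σ S + rank τ c + b + 1) := by
  induction h with
  | refl => exact Or.inl (by omega)
  | @step b σ τ i j hij _ ih =>
    by_cases hc : c ∈ S
    · simp only [hc, not_true_eq_false, false_and, or_false] at ih ⊢
      have hswap := (bestRank_swap τ hij hS c).resolve_right fun h => h.1 hc
      omega
    · have hne : ∀ ρ : Equiv.Perm (Fin m), rank ρ c ≠ bestRank ρ S := fun ρ h =>
        hc (mem_of_rank_eq_bestRank hS h)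
      have := hne τ
      have := hne ((Equiv.swap i j).trans τ)
      simp only [hc, not_false_eq_true, true_and] at ih ⊢
      rcases bestRank_swap τ hij hS c with h | ⟨-, h⟩ <;> rcases ih with ih | ih <;> omega

end Vote

section SwapReach

variable {m n B : ℕ} {E E' : Election m n}

theorem SwapReach.mono {B' : ℕ} (h : SwapReach B E E') (hB : B ≤ B') : SwapReach B' E E' := by
  induction h generalizing B' with
  | refl => exact .refl _ _
  | step _ hs ih =>
    obtain ⟨B'', rfl⟩ := Nat.exists_eq_add_of_le' (Nat.one_le_of_lt hB)
    exact .step (ih (Nat.le_of_succ_le_succ hB)) hs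

theorem SwapReach.trans {B' : ℕ} {E'' : Election m n} (h : SwapReach B E E')
    (h' : SwapReach B' E' E'') : SwapReach (B + B') E E'' := by
  induction h' with
  | refl => exact h.mono (Nat.le_add_right _ _)
  | step _ hs ih => exact .step (ih h) hs

theorem SwapReach.eq_of_zero (h : SwapReach 0 E E') : E' = E := by
  cases h
  rfl

theorem VoteReach.swapReach {b : ℕ} {σ τ : Equiv.Perm (Fin m)} {v : Fin n}
    (h : VoteReach b σ τ) (hv : E v = σ) : SwapReach b E (Function.update E v τ) := by
  induction h with
  | refl => rw [← hv, Function.update_eq_self]; exact .refl _ _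
  | step i j hij _ ih =>
    refine .step (ih hv) ⟨v, i, j, hij, ?_⟩
    rw [Function.update_self, Function.update_idem]

theorem swapReach_of_votes {b : Fin n → ℕ} (h : ∀ v, VoteReach (b v) (E v) (E' v)) :
    SwapReach (∑ v, b v) E E' := by
  have hpiecewise : ∀ s : Finset (Fin n), SwapReach (∑ v ∈ s, b v) E (s.piecewise E' E) := by
    intro s
    induction s using Finset.induction_on with
    | empty => simpa using SwapReach.refl 0 E
    | insert v s hv ih =>
      rw [sum_insert hv, add_comm, piecewise_insert]
      exact ih.trans ((h v).swapReach (piecewise_eq_of_notMem _ _ _ hv))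
  simpa using hpiecewise univ

theorem SwapReach.exists_votes (h : SwapReach B E E') :
    ∃ b : Fin n → ℕ, ∑ v, b v ≤ B ∧ ∀ v, VoteReach (b v) (E v) (E' v) := by
  induction h with
  | refl B E => exact ⟨0, by simp, fun v => .refl _⟩
  | step _ hs ih =>
    obtain ⟨b, hb, hreach⟩ := ih
    obtain ⟨v, i, j, hij, rfl⟩ := hs
    refine ⟨b + Pi.single v 1, ?_, fun u => ?_⟩
    · simpa only [Pi.add_apply, sum_add_distrib, sum_pi_single', mem_univ, if_true,
        add_le_add_iff_right]
    · rcases eq_or_ne u v with rfl | hu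
      · simpa using VoteReach.step i j hij (hreach u)
      · simpa [hu] using hreach u

end SwapReach

/-! ### Winning committees -/

section Winners

variable {m n k : ℕ} {E E' : Election m n} {S T : Finset (Fin m)} {c : Fin m}

/-- The sum of the best ranks of a committee. The score of a nonempty committee is the difference of
`n * (m - 1)` and this cost. -/
noncomputable def rankCost (E : Election m n) (S : Finset (Fin m)) : ℕ := ∑ v, bestRank (E v) S

theorem voteScore_eq_sub_bestRank (E : Election m n) (v : Fin n) (hS : S.Nonempty) :
    voteScore E v S = m - 1 - bestRank (E v) S := by
  have hborda : ∀ c, borda m (pos E v c) = m - 1 - rank (E v) c := fun c => by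
    rw [borda, pos, rank, Nat.sub_add_eq, Nat.sub_right_comm]
  obtain ⟨c, hc, hbest⟩ := exists_rank_eq_bestRank (E v) hS
  refine le_antisymm (Finset.sup_le fun d hd => ?_) ?_
  · rw [hborda]
    exact Nat.sub_le_sub_left (bestRank_le hd) _
  · rw [← hbest, ← hborda]
    exact le_sup (f := fun c => borda m (pos E v c)) hc

theorem voteScore_add_bestRank (E : Election m n) (v : Fin n) (hS : S.Nonempty) :
    voteScore E v S + bestRank (E v) S = m - 1 := by
  obtain ⟨c, -, hbest⟩ := exists_rank_eq_bestRank (E v) hS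
  rw [voteScore_eq_sub_bestRank E v hS,
    Nat.sub_add_cancel (hbest ▸ Nat.le_sub_one_of_lt (rank_lt (E v) c))]

theorem ccScore_add_rankCost (E : Election m n) (hS : S.Nonempty) :
    ccScore E S + rankCost E S = n * (m - 1) := by
  rw [ccScore, rankCost, ← sum_add_distrib, sum_congr rfl fun v _ => voteScore_add_bestRank E v hS]
  simp

theorem mem_betaCC_iff (hk : 0 < k) :
    S ∈ betaCC m n E k ↔ #S = k ∧ ∀ T : Finset (Fin m), #T = k → rankCost E S ≤ rankCost E T := by
  refine and_congr_right fun hS => forall₂_congr fun T hT => ?_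
  have hscoreS := ccScore_add_rankCost E (card_pos.1 (hk.trans_eq hS.symm))
  have hscoreT := ccScore_add_rankCost E (card_pos.1 (hk.trans_eq hT.symm))
  omega

theorem betaCC_nonempty (E : Election m n) (hkm : k ≤ m) : (betaCC m n E k).Nonempty := by
  obtain ⟨S, hS, hmax⟩ := exists_max_image (powersetCard k (univ : Finset (Fin m)))
    (ccScore E) (powersetCard_nonempty.2 (by simpa using hkm))
  exact ⟨S, (mem_powersetCard.1 hS).2, fun T hT =>
    hmax T (mem_powersetCard.2 ⟨subset_univ _, hT⟩)⟩

theorem betaCC_eq_setOf_card_eq (E : Election m n) (hk : k = 0 ∨ m ≤ k) :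
    betaCC m n E k = {S | #S = k} := by
  have hunique : ∀ S T : Finset (Fin m), #S = k → #T = k → S = T := by
    intro S T hS hT
    rcases hk with rfl | hk
    · rw [card_eq_zero.1 hS, card_eq_zero.1 hT]
    · have huniv : ∀ R : Finset (Fin m), #R = k → R = univ := fun R hR =>
        eq_univ_of_card R (le_antisymm (card_le_univ R) (by simpa [hR] using hk))
      rw [huniv S hS, huniv T hT]
  exact Set.ext fun S => ⟨fun h => h.1, fun h => ⟨h, fun T hT => by rw [hunique T S hT h]⟩⟩

/-- The candidates on top of some vote. -/
def tops (E : Election m n) : Finset (Fin m) := {c | ∃ v, rank (E v) c = 0}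

theorem mem_tops : c ∈ tops E ↔ ∃ v, rank (E v) c = 0 := by
  simp only [tops, mem_filter, mem_univ, true_and]

theorem card_tops_le (hm : 0 < m) (E : Election m n) : #(tops E) ≤ n := by
  have hsub : tops E ⊆ univ.image fun v => E v ⟨0, hm⟩ := fun c hc => by
    obtain ⟨v, hv⟩ := mem_tops.1 hc
    exact mem_image.2 ⟨v, mem_univ _, ((E v).eq_symm_apply.1 (Fin.ext hv.symm))⟩
  simpa using (card_le_card hsub).trans card_image_le

theorem tops_subset_of_forall_rankCost_le (hkm : k ≤ m) (hS : S.Nonempty) (hSk : #S < k)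
    (hopt : ∀ T : Finset (Fin m), #T = k → rankCost E S ≤ rankCost E T) : tops E ⊆ S := by
  intro c hc
  obtain ⟨v, hv⟩ := mem_tops.1 hc
  by_contra hcS
  obtain ⟨T, hT, hTk⟩ := exists_superset_card_eq (s := insert c S) ((card_insert_le _ _).trans hSk)
    (by simpa using hkm)
  have hcT : c ∈ T := hT (mem_insert_self _ _)
  have hST : S ⊆ T := (subset_insert _ _).trans hT
  refine absurd (hopt T hTk) (not_le.2 (sum_lt_sum
    (fun u _ => le_bestRank hS fun d hd => bestRank_le (hST hd)) ⟨v, mem_univ _, ?_⟩))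
  rw [(bestRank_eq_zero_iff ⟨c, hcT⟩ hv).2 hcT]
  exact Nat.pos_of_ne_zero fun h => hcS ((bestRank_eq_zero_iff hS hv).1 h)

theorem rankCost_eq_zero_iff (hm : 0 < m) (hS : S.Nonempty) : rankCost E S = 0 ↔ tops E ⊆ S := by
  rw [rankCost, sum_eq_zero_iff]
  constructor
  · intro h c hc
    obtain ⟨v, hv⟩ := mem_tops.1 hc
    exact (bestRank_eq_zero_iff hS hv).1 (h v (mem_univ _))
  · intro h v _
    obtain ⟨c, hc⟩ := exists_rank_eq (E v) hm
    exact (bestRank_eq_zero_iff hS hc).2 (h (mem_tops.2 ⟨v, hc⟩))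

theorem mem_betaCC_iff_tops_subset (hk : 0 < k) (hkm : k ≤ m) (htops : #(tops E) ≤ k) :
    S ∈ betaCC m n E k ↔ #S = k ∧ tops E ⊆ S := by
  have hzero : ∀ T : Finset (Fin m), #T = k → (rankCost E T = 0 ↔ tops E ⊆ T) := fun T hT =>
    rankCost_eq_zero_iff (hk.trans_le hkm) (card_pos.1 (hk.trans_eq hT.symm))
  rw [mem_betaCC_iff hk]
  refine and_congr_right fun hS => ?_
  rw [← hzero S hS]
  constructor
  · intro h
    obtain ⟨T, hT, hTk⟩ := exists_superset_card_eq htops (by simpa using hkm)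
    exact Nat.le_zero.1 ((h T hTk).trans_eq ((hzero T hTk).2 hT))
  · intro h T _
    exact h.le.trans (Nat.zero_le _)

theorem exists_card_eq_avoiding (hkm : k < m) (hS : #S ≤ k) (hc : c ∉ S) :
    ∃ T : Finset (Fin m), #T = k ∧ S ⊆ T ∧ c ∉ T := by
  obtain ⟨T, hST, hT, hTk⟩ := exists_subsuperset_card_eq (t := univ.erase c)
    (fun x hx => mem_erase.2 ⟨fun h => hc (h ▸ hx), mem_univ _⟩) hS
    (by simpa using Nat.le_sub_one_of_lt hkm)
  exact ⟨T, hTk, hST, fun h => notMem_erase _ _ (hT h)⟩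

theorem betaCC_eq_iff_tops_eq (hk : 0 < k) (hkm : k < m) (htops : #(tops E) ≤ k)
    (htops' : #(tops E') ≤ k) : betaCC m n E k = betaCC m n E' k ↔ tops E = tops E' := by
  have hsub : ∀ {F F' : Election m n}, #(tops F) ≤ k → #(tops F') ≤ k →
      betaCC m n F k = betaCC m n F' k → tops F' ⊆ tops F := by
    intro F F' hF hF' h c hc
    by_contra hcF
    obtain ⟨T, hTk, hT, hcT⟩ := exists_card_eq_avoiding hkm hF hcF
    have hmem := (mem_betaCC_iff_tops_subset hk hkm.le hF).2 ⟨hTk, hT⟩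
    rw [h, mem_betaCC_iff_tops_subset hk hkm.le hF'] at hmem
    exact hcT (hmem.2 hc)
  refine ⟨fun h => (hsub htops' htops h.symm).antisymm (hsub htops htops' h), fun h => ?_⟩
  ext S
  rw [mem_betaCC_iff_tops_subset hk hkm.le htops, mem_betaCC_iff_tops_subset hk hkm.le htops', h]

end Winners

/-! ### Fewer top candidates than seats -/

section FewTops

variable {m n k B : ℕ} {E E' : Election m n} {c : Fin m} {v : Fin n}

theorem exists_rank_le_of_mem_tops (h : SwapReach B E E') (hc : c ∈ tops E') :
    ∃ v, rank (E v) c ≤ B := by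
  obtain ⟨b, hb, hvote⟩ := h.exists_votes
  obtain ⟨v, hv⟩ := mem_tops.1 hc
  refine ⟨v, ((hvote v).rank_le c).trans ?_⟩
  rw [hv, zero_add]
  exact (single_le_sum (fun _ _ => Nat.zero_le _) (mem_univ v)).trans hb

theorem card_rank_eq_zero_le_of_notMem_tops (h : SwapReach B E E') (hc : c ∉ tops E') :
    #{v | rank (E v) c = 0} ≤ B := by
  obtain ⟨b, hb, hvote⟩ := h.exists_votes
  rw [card_filter]
  refine (sum_le_sum fun v _ => ?_).trans hb
  split_ifs with hv
  · refine Nat.pos_of_ne_zero fun hzero => hc (mem_tops.2 ⟨v, ?_⟩)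
    have hvote₀ : VoteReach 0 (E v) (E' v) := hzero ▸ hvote v
    rw [hvote₀.eq_of_zero, hv]
  · exact Nat.zero_le _

theorem robustnessRadius_of_rank_le (hkm : k < m) (htops : #(tops E) < k)
    (hc : c ∉ tops E) (hr : rank (E v) c ≤ B) : RobustnessRadius betaCC ⟨m, n, E, k, B⟩ := by
  obtain ⟨τ, hτ, htop, -⟩ := exists_raise_to (zero_add (rank (E v) c)).symm
  have hsub : tops (Function.update E v τ) ⊆ insert c (tops E) := by
    intro d hd
    obtain ⟨u, hu⟩ := mem_tops.1 hd
    rcases eq_or_ne u v with rfl | huv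
    · rw [Function.update_self] at hu
      exact rank_injective τ (hu.trans htop.symm) ▸ mem_insert_self _ _
    · rw [Function.update_of_ne huv] at hu
      exact mem_insert_of_mem (mem_tops.2 ⟨u, hu⟩)
  have hcard : #(tops (Function.update E v τ)) ≤ k :=
    (card_le_card hsub).trans ((card_insert_le _ _).trans htops)
  have hmem : c ∈ tops (Function.update E v τ) := mem_tops.2 ⟨v, by rwa [Function.update_self]⟩
  exact ⟨_, (hτ.swapReach rfl).mono hr, fun h =>
    hc ((betaCC_eq_iff_tops_eq (Nat.zero_lt_of_lt htops) hkm hcard htops.le).1 h ▸ hmem)⟩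

theorem exists_notMem_tops (hm : 1 < m) (E : Election m n) (c : Fin m) :
    ∃ E', SwapReach #{v | rank (E v) c = 0} E E' ∧ c ∉ tops E' ∧
      ∀ d ∈ tops E', d ∈ tops E ∨ ∃ v, rank (E v) c = 0 ∧ rank (E v) d = 1 := by
  have hvote : ∀ v, ∃ τ, VoteReach (if rank (E v) c = 0 then 1 else 0) (E v) τ ∧ rank τ c ≠ 0 ∧
      ∀ d, rank τ d = 0 → d ∈ tops E ∨ ∃ v, rank (E v) c = 0 ∧ rank (E v) d = 1 := by
    intro v
    split_ifs with hv
    · obtain ⟨d, hd⟩ := exists_rank_eq (E v) hm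
      obtain ⟨τ, hτ, htop, -⟩ := exists_raise hd
      refine ⟨τ, hτ, fun h => ?_, fun e he => Or.inr ⟨v, hv, ?_⟩⟩
      · rw [rank_injective τ (h.trans htop.symm), hd] at hv
        exact one_ne_zero hv
      · rw [rank_injective τ (he.trans htop.symm), hd]
    · exact ⟨E v, .refl _, hv, fun d hd => Or.inl (mem_tops.2 ⟨v, hd⟩)⟩
  choose E' hreach hc hd using hvote
  refine ⟨E', card_filter (fun v => rank (E v) c = 0) univ ▸ swapReach_of_votes hreach, ?_, ?_⟩
  · simpa only [mem_tops, not_exists] using hc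
  · intro d hmem
    obtain ⟨v, hv⟩ := mem_tops.1 hmem
    exact hd v d hv

theorem robustnessRadius_of_card_rank_eq_zero_le (hkm : k < m)
    (htops : #(tops E) < k) (hc : c ∈ tops E) (hB : #{v | rank (E v) c = 0} ≤ B) :
    RobustnessRadius betaCC ⟨m, n, E, k, B⟩ := by
  by_cases hnew : ∃ v d, rank (E v) c = 0 ∧ rank (E v) d = 1 ∧ d ∉ tops E
  · obtain ⟨v, d, hvc, hvd, hd⟩ := hnew
    refine robustnessRadius_of_rank_le hkm htops hd (hvd.trans_le (le_trans ?_ hB))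
    exact card_pos.2 ⟨v, mem_filter.2 ⟨mem_univ _, hvc⟩⟩
  · push Not at hnew
    obtain ⟨E', hreach, hcE', htopsE'⟩ := exists_notMem_tops (by omega) E c
    have hsub : tops E' ⊆ tops E := fun d hd =>
      (htopsE' d hd).elim id fun ⟨v, hvc, hvd⟩ => hnew v d hvc hvd
    exact ⟨E', hreach.mono hB, fun h => hcE' ((betaCC_eq_iff_tops_eq (Nat.zero_lt_of_lt htops) hkm
      ((card_le_card hsub).trans htops.le) htops.le).1 h ▸ hc)⟩

theorem robustnessRadius_iff_of_card_tops_lt (hkm : k < m) (htops : #(tops E) < k) :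
    RobustnessRadius betaCC ⟨m, n, E, k, B⟩ ↔ ∃ c, (c ∉ tops E ∧ ∃ v, rank (E v) c ≤ B) ∨
      (c ∈ tops E ∧ #{v | rank (E v) c = 0} ≤ B) := by
  constructor
  · rintro ⟨E', hreach, hne⟩
    by_cases hsub : tops E' ⊆ tops E
    · have hcard : #(tops E') ≤ k := (card_le_card hsub).trans htops.le
      obtain ⟨c, hc, hc'⟩ := exists_of_ssubset (hsub.ssubset_of_ne fun h =>
        hne ((betaCC_eq_iff_tops_eq (Nat.zero_lt_of_lt htops) hkm hcard htops.le).2 h))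
      exact ⟨c, Or.inr ⟨hc, card_rank_eq_zero_le_of_notMem_tops hreach hc'⟩⟩
    · obtain ⟨c, hc, hc'⟩ := not_subset.1 hsub
      exact ⟨c, Or.inl ⟨hc', exists_rank_le_of_mem_tops hreach hc⟩⟩
  · rintro ⟨c, ⟨hc, v, hv⟩ | ⟨hc, hv⟩⟩
    · exact robustnessRadius_of_rank_le hkm htops hc hv
    · exact robustnessRadius_of_card_rank_eq_zero_le hkm htops hc hv

end FewTops

/-! ### At least as many top candidates as seats -/

section ManyTops

variable {m n k B : ℕ} {E E' : Election m n} {S T : Finset (Fin m)} {rep : Fin n → Fin m}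
  {U : Finset (Fin n)} {s : Fin m}

/-- The representatives `rep v` of the voters `v` fit in a committee of size `k` without `s ∈ S`,
and `B` swaps suffice to make them as good as the committee `S`, where they overtake `S` in the
votes of `U`. -/
structure Overtaking (E : Election m n) (k B : ℕ) (S : Finset (Fin m)) (rep : Fin n → Fin m)
    (U : Finset (Fin n)) (s : Fin m) : Prop where
  mem : s ∈ S
  card_le : #(univ.image rep) ≤ k
  ne : ∀ v, rep v ≠ s
  below : ∀ v ∈ U, rep v ∉ S ∧ bestRank (E v) S < rank (E v) (rep v)
  marked_le : ∑ v ∈ U, rank (E v) (rep v) ≤ B + ∑ v ∈ U, bestRank (E v) S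
  total_le : ∑ v, rank (E v) (rep v) ≤ B + #U + rankCost E S

theorem rankCost_le_sum_rank (hrep : ∀ v, rep v ∈ T) :
    rankCost E T ≤ ∑ v, rank (E v) (rep v) :=
  sum_le_sum fun v _ => bestRank_le (hrep v)

theorem exists_sum_rank_eq_rankCost (E : Election m n) (hT : T.Nonempty) :
    ∃ rep : Fin n → Fin m, (∀ v, rep v ∈ T) ∧ ∑ v, rank (E v) (rep v) = rankCost E T := by
  choose rep hmem hrank using fun v => exists_rank_eq_bestRank (E v) hT
  exact ⟨rep, hmem, sum_congr rfl fun v _ => hrank v⟩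

theorem card_image_rep_le (hrep : ∀ v, rep v ∈ T) : #(univ.image rep) ≤ #T :=
  card_le_card (image_subset_iff.2 fun v _ => hrep v)

theorem exists_overtaking_of_mem_betaCC (hk : 0 < k) (hS : #S = k) (hreach : SwapReach B E E')
    (hT : T ∈ betaCC m n E' k) (hTS : T ≠ S) : ∃ rep U s, Overtaking E k B S rep U s := by
  obtain ⟨hTk, hopt⟩ := (mem_betaCC_iff hk).1 hT
  obtain ⟨s, hs, hsT⟩ := not_subset.1 fun h : S ⊆ T =>
    hTS (eq_of_subset_of_card_le h (hTk.trans hS.symm).le).symm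
  obtain ⟨rep, hrep, hcost⟩ := exists_sum_rank_eq_rankCost E' (card_pos.1 (hk.trans_eq hTk.symm))
  obtain ⟨b, hb, hvote⟩ := hreach.exists_votes
  let U : Finset (Fin n) := {v | rep v ∉ S ∧ bestRank (E v) S < rank (E v) (rep v) ∧
    rank (E v) (rep v) ≤ bestRank (E v) S + b v}
  have hU : ∀ {v}, v ∈ U ↔ rep v ∉ S ∧ bestRank (E v) S < rank (E v) (rep v) ∧
      rank (E v) (rep v) ≤ bestRank (E v) S + b v := by
    simp only [U, mem_filter, mem_univ, true_and, implies_true]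
  refine ⟨rep, U, s, hs, hTk ▸ card_image_rep_le hrep, fun v h => hsT (h ▸ hrep v),
    fun v hv => ⟨(hU.1 hv).1, (hU.1 hv).2.1⟩, ?_, ?_⟩
  · calc ∑ v ∈ U, rank (E v) (rep v)
      _ ≤ ∑ v ∈ U, (b v + bestRank (E v) S) :=
        sum_le_sum fun v hv => (hU.1 hv).2.2.trans_eq (Nat.add_comm _ _)
      _ = ∑ v ∈ U, b v + ∑ v ∈ U, bestRank (E v) S := sum_add_distrib
      _ ≤ B + ∑ v ∈ U, bestRank (E v) S := by
        gcongr
        exact (sum_le_sum_of_subset (subset_univ U)).trans hb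
  · have hgain : ∑ v, (bestRank (E' v) S + rank (E v) (rep v)) ≤
        ∑ v, (bestRank (E v) S + rank (E' v) (rep v) + b v + if v ∈ U then 1 else 0) := by
      refine sum_le_sum fun v _ => ?_
      rcases (hvote v).gain_le (card_pos.1 (hk.trans_eq hS.symm)) (rep v) with
        h | ⟨hnotMem, hbelow, -, hle, h⟩
      · exact Nat.le_add_right_of_le h
      · rwa [if_pos (hU.2 ⟨hnotMem, hbelow, hle⟩)]
    have hTS := hopt S hS
    simp only [sum_add_distrib, hcost, sum_boole, filter_univ_mem, Nat.cast_id] at hgain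
    simp only [rankCost] at hgain hTS ⊢
    omega

theorem exists_overtaking_of_robustnessRadius (hk : 0 < k) (hkm : k ≤ m) (hS : #S = k)
    (h : RobustnessRadius betaCC ⟨m, n, E, k, B⟩) : ∃ rep U s, Overtaking E k B S rep U s := by
  obtain ⟨E', hreach, hne⟩ := h
  by_cases hwin : ∀ T ∈ betaCC m n E k, T = S
  · obtain ⟨T, hT, hTS⟩ : ∃ T ∈ betaCC m n E' k, T ≠ S := by
      by_contra! hwin'
      refine hne ?_
      exact (Set.eq_singleton_iff_nonempty_unique_mem.2 ⟨betaCC_nonempty E' hkm, hwin'⟩).trans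
        (Set.eq_singleton_iff_nonempty_unique_mem.2 ⟨betaCC_nonempty E hkm, hwin⟩).symm
    exact exists_overtaking_of_mem_betaCC hk hS hreach hT hTS
  · push Not at hwin
    obtain ⟨T, hT, hTS⟩ := hwin
    exact exists_overtaking_of_mem_betaCC hk hS (.refl B E) hT hTS

theorem sum_update_add (E : Election m n) (v : Fin n) (τ : Equiv.Perm (Fin m))
    (f : Fin n → Equiv.Perm (Fin m) → ℕ) :
    ∑ u, f u (Function.update E v τ u) + f v (E v) = ∑ u, f u (E u) + f v τ := by
  rw [← add_sum_erase univ _ (mem_univ v), ← add_sum_erase univ (fun u => f u (E u)) (mem_univ v),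
    Function.update_self, sum_congr rfl fun u hu => by
      rw [Function.update_of_ne (ne_of_mem_erase hu)]]
  omega

theorem rankCost_update_add (E : Election m n) (v : Fin n) (τ : Equiv.Perm (Fin m))
    (S : Finset (Fin m)) :
    rankCost (Function.update E v τ) S + bestRank (E v) S = rankCost E S + bestRank τ S :=
  sum_update_add E v τ fun _ σ => bestRank σ S

theorem exists_sum_rank_le_rankCost (hS : S.Nonempty) {d : ℕ}
    (h : ∑ v, rank (E v) (rep v) ≤ rankCost E S + d) :
    ∃ E', SwapReach d E E' ∧ ∑ v, rank (E' v) (rep v) ≤ rankCost E' S := by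
  induction d generalizing E with
  | zero => exact ⟨E, .refl _ _, h⟩
  | succ d ih =>
    by_cases hle : ∑ v, rank (E v) (rep v) ≤ rankCost E S
    · exact ⟨E, .refl _ _, hle⟩
    obtain ⟨v, -, hv⟩ := exists_lt_of_sum_lt (not_le.1 hle)
    obtain ⟨r, hr⟩ := Nat.exists_eq_add_of_le' (Nat.one_le_of_lt hv)
    obtain ⟨τ, hτ, hrank, hothers⟩ := exists_raise hr
    have hbest : bestRank (E v) S ≤ bestRank τ S := by
      refine le_bestRank hS fun c hc => ?_
      rcases eq_or_ne c (rep v) with rfl | hne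
      · omega
      · exact (bestRank_le hc).trans (hothers c hne)
    have hrep := sum_update_add E v τ fun u σ => rank σ (rep u)
    have hcost := rankCost_update_add E v τ S
    obtain ⟨E', hreach, hE'⟩ := ih (E := Function.update E v τ) (by omega)
    exact ⟨E', Nat.add_comm 1 d ▸ (hτ.swapReach rfl).trans hreach, hE'⟩

theorem robustnessRadius_one_of_rank_eq_bestRank (hk : 0 < k) {v : Fin n} {c : Fin m}
    (hS : S ∈ betaCC m n E k) (hT : T ∈ betaCC m n E k) (hcT : c ∈ T)
    (hc : rank (E v) c = bestRank (E v) T) (hc0 : rank (E v) c ≠ 0)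
    (h : c ∉ S ∨ bestRank (E v) S = 0) : RobustnessRadius betaCC ⟨m, n, E, k, 1⟩ := by
  obtain ⟨hSk, hSopt⟩ := (mem_betaCC_iff hk).1 hS
  obtain ⟨hTk, hTopt⟩ := (mem_betaCC_iff hk).1 hT
  obtain ⟨r, hr⟩ := Nat.exists_eq_succ_of_ne_zero hc0
  obtain ⟨τ, hτ, hrank, hothers⟩ := exists_raise hr
  have hSτ : bestRank (E v) S ≤ bestRank τ S := by
    rcases h with hcS | hzero
    · exact le_bestRank (card_pos.1 (hk.trans_eq hSk.symm)) fun d hd =>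
        (bestRank_le hd).trans (hothers d fun h => hcS (h ▸ hd))
    · exact hzero.trans_le (Nat.zero_le _)
  have hTτ : bestRank τ T ≤ rank τ c := bestRank_le hcT
  refine ⟨Function.update E v τ, hτ.swapReach rfl, fun hE => ?_⟩
  have hS' : S ∈ betaCC m n (Function.update E v τ) k := hE.symm ▸ hS
  have hle := ((mem_betaCC_iff hk).1 hS').2 T hTk
  have hST := hSopt T hTk
  have hTS := hTopt S hSk
  have hcostS := rankCost_update_add E v τ S
  have hcostT := rankCost_update_add E v τ T
  omega

theorem exists_notMem_rank_eq_bestRank (hk : 0 < k) (htops : k ≤ #(tops E)) (hS : #S = k)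
    (hT : T ∈ betaCC m n E k) (hTS : T ≠ S) :
    ∃ v, ∃ c ∈ T, c ∉ S ∧ rank (E v) c = bestRank (E v) T := by
  obtain ⟨hTk, hopt⟩ := (mem_betaCC_iff hk).1 hT
  have hT0 : T.Nonempty := card_pos.1 (hk.trans_eq hTk.symm)
  by_contra! hmem
  choose rep hrep hbest using fun v => exists_rank_eq_bestRank (E v) hT0
  have hinter : ∀ v, rep v ∈ T ∩ S := fun v =>
    mem_inter.2 ⟨hrep v, by_contra fun h => hmem v (rep v) (hrep v) h (hbest v)⟩
  have hcost : rankCost E (T ∩ S) ≤ rankCost E T :=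
    (rankCost_le_sum_rank hinter).trans_eq (sum_congr rfl fun v _ => hbest v)
  have hlt : #(T ∩ S) < k := hTk ▸ card_lt_card (inter_subset_left.ssubset_of_ne fun h =>
    hTS (eq_of_subset_of_card_le (inter_eq_left.1 h) (hS.trans hTk.symm).le))
  obtain ⟨c, hc⟩ : (tops E).Nonempty := card_pos.1 (hk.trans_le htops)
  obtain ⟨v, -⟩ := mem_tops.1 hc
  have hkm : k ≤ m := htops.trans (card_finset_fin_le _)
  have hsub := tops_subset_of_forall_rankCost_le hkm ⟨rep v, hinter v⟩ hlt fun R hR =>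
    hcost.trans (hopt R hR)
  exact absurd (card_le_card hsub) (not_le.2 (hlt.trans_le htops))

theorem robustnessRadius_one_of_tie (hk : 0 < k) (htops : k ≤ #(tops E))
    (hS : S ∈ betaCC m n E k) (hT : T ∈ betaCC m n E k) (hTS : T ≠ S) :
    RobustnessRadius betaCC ⟨m, n, E, k, 1⟩ := by
  obtain ⟨v, c, hcT, hcS, hc⟩ := exists_notMem_rank_eq_bestRank hk htops hS.1 hT hTS
  by_cases hc0 : rank (E v) c = 0
  · obtain ⟨d, hdS, hd⟩ := exists_rank_eq_bestRank (E v) (card_pos.1 (hk.trans_eq hS.1.symm))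
    have hd0 : rank (E v) d ≠ 0 := fun h => hcS (rank_injective _ (h.trans hc0.symm) ▸ hdS)
    exact robustnessRadius_one_of_rank_eq_bestRank hk hT hS hdS hd hd0 (.inr (hc ▸ hc0))
  · exact robustnessRadius_one_of_rank_eq_bestRank hk hS hT hcT hc hc0 (.inl hcS)

namespace Overtaking

theorem exists_swapReach_marked (h : Overtaking E k B S rep U s) : ∃ b ≤ B, ∃ E',
    SwapReach b E E' ∧ ∑ v, rank (E' v) (rep v) ≤ rankCost E' S + (B - b) := by
  let b : Fin n → ℕ := fun v => if v ∈ U then rank (E v) (rep v) - bestRank (E v) S else 0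
  have hvote : ∀ v, ∃ τ, VoteReach (b v) (E v) τ ∧
      rank τ (rep v) + bestRank (E v) S + (if v ∈ U then 1 else 0) + b v ≤
        bestRank τ S + rank (E v) (rep v) := by
    intro v
    by_cases hv : v ∈ U
    · obtain ⟨hnotMem, hbelow⟩ := h.below v hv
      simp only [b, if_pos hv]
      obtain ⟨τ, hτ, hlt⟩ := exists_overtake ⟨s, h.mem⟩ hnotMem
        (Nat.add_sub_of_le hbelow.le).symm
      exact ⟨τ, hτ, by omega⟩
    · simp only [b, if_neg hv]
      exact ⟨E v, .refl _, by omega⟩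
  choose E' hreach hgain using hvote
  have hb : ∑ v, b v + ∑ v ∈ U, bestRank (E v) S = ∑ v ∈ U, rank (E v) (rep v) := by
    rw [sum_ite_mem, univ_inter, ← sum_add_distrib]
    exact sum_congr rfl fun v hv => Nat.sub_add_cancel (h.below v hv).2.le
  have hmarked := h.marked_le
  refine ⟨∑ v, b v, by omega, E', swapReach_of_votes hreach, ?_⟩
  have hsum := sum_le_sum fun v (_ : v ∈ univ) => hgain v
  have htotal := h.total_le
  simp only [sum_add_distrib, sum_boole, filter_univ_mem, Nat.cast_id] at hsum
  simp only [rankCost] at htotal ⊢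
  omega

theorem robustnessRadius (h : Overtaking E k B S rep U s) (hk : 0 < k) (hkm : k < m) (hB : 0 < B)
    (htops : k ≤ #(tops E)) (hS : S ∈ betaCC m n E k) :
    RobustnessRadius betaCC ⟨m, n, E, k, B⟩ := by
  obtain ⟨T, hTk, himage, hsT⟩ := exists_card_eq_avoiding hkm h.card_le (c := s) (by
    simpa using h.ne)
  have hrep : ∀ v, rep v ∈ T := fun v => himage (mem_image_of_mem _ (mem_univ _))
  by_cases hT : T ∈ betaCC m n E k
  · obtain ⟨E', hreach, hne⟩ := robustnessRadius_one_of_tie hk htops hS hT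
      fun hTS => hsT (hTS ▸ h.mem)
    exact ⟨E', hreach.mono hB, hne⟩
  · obtain ⟨b, hb, E₁, hreach₁, hle₁⟩ := h.exists_swapReach_marked
    obtain ⟨E', hreach, hle⟩ := exists_sum_rank_le_rankCost ⟨s, h.mem⟩ hle₁
    refine ⟨E', (hreach₁.trans hreach).mono (Nat.add_sub_of_le hb).le, fun hE => hT ?_⟩
    have hS' : S ∈ betaCC m n E' k := hE.symm ▸ hS
    refine hE ▸ (mem_betaCC_iff hk).2 ⟨hTk, fun R hR => ?_⟩
    exact ((rankCost_le_sum_rank hrep).trans hle).trans (((mem_betaCC_iff hk).1 hS').2 R hR)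

end Overtaking

theorem robustnessRadius_iff_exists_overtaking (hk : 0 < k) (hkm : k < m) (hB : 0 < B)
    (htops : k ≤ #(tops E)) (hS : S ∈ betaCC m n E k) :
    RobustnessRadius betaCC ⟨m, n, E, k, B⟩ ↔ ∃ rep U s, Overtaking E k B S rep U s :=
  ⟨exists_overtaking_of_robustnessRadius hk hkm.le hS.1,
    fun ⟨_, _, _, h⟩ => h.robustnessRadius hk hkm hB htops hS⟩

end ManyTops

/-! ### The algorithm -/

section Algorithm

variable (w φ ψ u t : ℕ → ℕ)

/-- The candidate at place `i` in vote `v` of the encoded election `w`. The encoding starts with the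
number of voters `w 0`, the number of candidates `w 1`, the size of the committees `w 2` and the
number of swaps `w 3`. -/
def cand (v i : ℕ) : ℕ := w (4 + v * w 1 + i)

/-- The number of candidates above `c` in the vote `v`. -/
noncomputable def rk (v c : ℕ) : ℕ := sInf {i | i < w 1 ∧ cand w v i = c}

/-- The sum of the ranks of `c` in the votes of cluster `j` of `φ`. -/
noncomputable def clusterSum (j c : ℕ) : ℕ := ∑ v ∈ range (w 0) with φ v = j, rk w v c

/-- The least rank sum of a candidate other than `a` in cluster `j` of `φ`. The choice `a = w 1`
excludes no candidate. -/
noncomputable def clusterMin (j a : ℕ) : ℕ := sInf {x | ∃ c < w 1, c ≠ a ∧ clusterSum w φ j c = x}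

/-- `φ` assigns all voters to the clusters `0, …, w 2 - 1`. -/
def Clustering : Prop := ∀ v < w 0, φ v < w 2

/-- The sum of the least rank sums of the clusters of `φ`. -/
noncomputable def clusterCost : ℕ := ∑ j ∈ range (w 2), clusterMin w φ j (w 1)

/-- `φ` is a clustering of least cost. -/
def Optimal : Prop :=
  Clustering w φ ∧ ∀ φ' ∈ guesses (w 0), Clustering w φ' → clusterCost w φ ≤ clusterCost w φ'

/-- The first candidate of least rank sum in cluster `j` of `φ`. -/
noncomputable def leader (j : ℕ) : ℕ :=
  sInf {c | c < w 1 ∧ clusterSum w φ j c = clusterMin w φ j (w 1)}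

/-- `c` leads some cluster of `φ`. -/
def IsLeader (c : ℕ) : Prop := ∃ j < w 2, leader w φ j = c

/-- The rank of the best leader of `φ` in the vote `v`. -/
noncomputable def leaderRank (v : ℕ) : ℕ := sInf {i | ∃ j < w 2, rk w v (leader w φ j) = i}

/-- The sum of the ranks of `c` in the votes of cluster `j` of `ψ` that are marked by `u`. -/
noncomputable def markedSum (j c : ℕ) : ℕ := ∑ v ∈ range (w 0) with ψ v = j ∧ u v = 1, rk w v c

/-- The candidate `c ≠ a` may represent the cluster `j` of `ψ` with the excess given by `t`: its
rank sum is within the excess, and if there are marked votes in the cluster, then it is no leader of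
`φ` and is below all leaders in these votes. -/
def Allowed (a j c : ℕ) : Prop :=
  (c ≠ a ∧ clusterSum w ψ j c ≤ clusterMin w ψ j a + t j) ∧
    ∀ v < w 0, ψ v = j ∧ u v = 1 → ¬IsLeader w φ c ∧ leaderRank w φ v < rk w v c

/-- The least marked rank sum of a candidate that may represent the cluster `j`. -/
noncomputable def markedMin (a j : ℕ) : ℕ :=
  sInf {x | ∃ c < w 1, Allowed w φ ψ u t a j c ∧ markedSum w ψ u j c = x}

/-- The guessed data describe a committee without `a` that overtakes the leaders of `φ` within `w 3`
swaps: its members represent the clusters of `ψ`, and they are swapped upwards in the marked votes,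
to the place of the best leader or one place higher. -/
def Overtakes (a : ℕ) : Prop :=
  (∀ j < w 2, ∃ c < w 1, Allowed w φ ψ u t a j c) ∧
  ∑ j ∈ range (w 2), markedMin w φ ψ u t a j ≤
    w 3 + ∑ v ∈ range (w 0) with u v = 1, leaderRank w φ v ∧
  ∑ j ∈ range (w 2), (clusterMin w ψ j a + t j) ≤
    w 3 + #{v ∈ range (w 0) | u v = 1} + ∑ v ∈ range (w 0), leaderRank w φ v

/-- The leaders of `φ` can be overtaken by a different committee. -/
def Overtaken : Prop :=
  ∃ j < w 2, ∃ ψ ∈ guesses (w 0), Clustering w ψ ∧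
    ∃ u ∈ guesses (w 0), ∃ t ∈ guesses (w 0), Overtakes w φ ψ u t (leader w φ j)

/-- The number of votes with the candidate `c` on top. -/
def topCount (c : ℕ) : ℕ := #{v ∈ range (w 0) | cand w v 0 = c}

/-- The number of candidates that are on top of some vote. -/
def numTops : ℕ := #{c ∈ range (w 1) | topCount w c ≠ 0}

/-- The set of top candidates can be changed by `w 3` swaps. -/
def TopsChange : Prop := ∃ c < w 1,
  (topCount w c = 0 ∧ ∃ v < w 0, rk w v c ≤ w 3) ∨ (topCount w c ≠ 0 ∧ topCount w c ≤ w 3)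

/-- The answer of the algorithm. If fewer than `w 2` candidates are on top of a vote, then the
winning committees are those that contain all of these. -/
def Answer : Prop :=
  ((0 < w 0 ∧ 0 < w 2) ∧ w 2 < w 1 ∧ 0 < w 3) ∧
    ((numTops w < w 2 ∧ TopsChange w) ∨
      (w 2 ≤ numTops w ∧ ∃ φ ∈ guesses (w 0), Optimal w φ ∧ Overtaken w φ))

end Algorithm

theorem rk_le (w : ℕ → ℕ) (v c : ℕ) : rk w v c ≤ w 1 := by
  rcases Set.eq_empty_or_nonempty {i | i < w 1 ∧ cand w v i = c} with h | h
  · rw [rk, h, Nat.sInf_empty]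
    exact Nat.zero_le _
  · exact (Nat.sInf_mem h).1.le

theorem sum_rk_le (w : ℕ → ℕ) (p : ℕ → Prop) [DecidablePred p] (c : ℕ) :
    ∑ v ∈ range (w 0) with p v, rk w v c ≤ w 0 * w 1 :=
  calc ∑ v ∈ range (w 0) with p v, rk w v c
    _ ≤ ∑ v ∈ range (w 0), rk w v c :=
      sum_le_sum_of_subset (filter_subset _ _)
    _ ≤ w 0 * w 1 := by
      simpa using sum_le_card_nsmul (range (w 0)) _ _ fun v _ => rk_le w v c

/-- The bound `b` exceeds all numbers over which the algorithm searches on the input `w`. -/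
structure Large (w : ℕ → ℕ) (b : ℕ) : Prop where
  n_lt : w 0 < b
  m_lt : w 1 < b
  k_le : w 2 ≤ b
  mul_lt : w 0 * w 1 < b
  pow_le : (w 0 + 1) ^ w 0 ≤ b

namespace Large

variable {d : ℕ} {φ ψ u t : State → ℕ → ℕ} {a c i j v : State → ℕ}

theorem evaluable_input (x : ℕ) : Evaluable Large d fun s => s.input x :=
  (Evaluable.const x).input

theorem evaluable_cand (hv : Evaluable Large d v) (hi : Evaluable Large d i) :
    Evaluable Large d fun s => cand s.input (v s) (i s) :=
  (((Evaluable.const 4).add (hv.mul (evaluable_input 1) fun _ h => h.m_lt.le)).add hi).input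

theorem evaluable_rk (hv : Evaluable Large d v) (hc : Evaluable Large d c) :
    Evaluable Large d fun s => rk s.input (v s) (c s) :=
  (evaluable_input 1).sInf (fun _ h => h.m_lt.le)
    (fun _ he _ hi => (EvaluablePred.lt hi (evaluable_input 1)).and
      (.eq (evaluable_cand (hv.mono he) hi) (hc.mono he)))
    fun _ _ _ hi => hi.1

theorem evaluable_clusterSum (hφ : EvaluableFun Large d φ) (hj : Evaluable Large d j)
    (hc : Evaluable Large d c) : Evaluable Large d fun s => clusterSum s.input (φ s) (j s) (c s) :=
  (evaluable_input 0).sum_filter (fun _ h => h.n_lt.le)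
    (fun e he _ hv => .eq (hφ e he _ hv) (hj.mono he))
    fun _ he _ hv => evaluable_rk hv (hc.mono he)

theorem evaluable_clusterMin (hφ : EvaluableFun Large d φ) (hj : Evaluable Large d j)
    (ha : Evaluable Large d a) : Evaluable Large d fun s => clusterMin s.input (φ s) (j s) (a s) :=
  (((evaluable_input 0).mul (evaluable_input 1) fun _ h => h.m_lt.le).add (.const 1)).sInf
    (fun _ h => h.mul_lt)
    (fun _ he _ hx => .exists_lt (evaluable_input 1) (fun _ h => h.m_lt.le) fun _ he' _ hc =>
      (EvaluablePred.eq hc (ha.mono (he.trans he'))).not.and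
        (.eq (evaluable_clusterSum (hφ.mono (he.trans he')) (hj.mono (he.trans he')) hc)
          (hx.mono he')))
    fun _ _ _ ⟨_, _, _, hx⟩ => hx ▸ Nat.lt_succ_of_le (sum_rk_le _ _ _)

theorem evaluablePred_clustering (hφ : EvaluableFun Large d φ) :
    EvaluablePred Large d fun s => Clustering s.input (φ s) :=
  .forall_lt (evaluable_input 0) (fun _ h => h.n_lt.le) fun e he _ hv =>
    .lt (hφ e he _ hv) (evaluable_input 2)

theorem evaluable_clusterCost (hφ : EvaluableFun Large d φ) :
    Evaluable Large d fun s => clusterCost s.input (φ s) :=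
  (evaluable_input 2).sum (fun _ h => h.k_le) fun _ he _ hj =>
    evaluable_clusterMin (hφ.mono he) hj (evaluable_input 1)

theorem evaluablePred_exists_guess {A : State → (ℕ → ℕ) → Prop}
    (hA : ∀ e ≥ d, ∀ φ, EvaluableFun Large e φ → EvaluablePred Large e fun s => A s (φ s)) :
    EvaluablePred Large d fun s => ∃ φ ∈ guesses (s.input 0), A s φ :=
  .exists_guess (evaluable_input 0) (fun _ h => h.n_lt) (fun _ h => h.pow_le) hA

theorem evaluablePred_optimal (hφ : EvaluableFun Large d φ) :
    EvaluablePred Large d fun s => Optimal s.input (φ s) := by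
  have h := (evaluablePred_exists_guess
    (A := fun s φ' => Clustering s.input φ' ∧ ¬clusterCost s.input (φ s) ≤ clusterCost s.input φ')
    fun e he φ' hφ' => (evaluablePred_clustering hφ').and
      (EvaluablePred.le (evaluable_clusterCost (hφ.mono he)) (evaluable_clusterCost hφ')).not).not
  simpa only [Optimal, not_exists, not_and, not_not] using (evaluablePred_clustering hφ).and h

theorem evaluable_leader (hφ : EvaluableFun Large d φ) (hj : Evaluable Large d j) :
    Evaluable Large d fun s => leader s.input (φ s) (j s) :=
  (evaluable_input 1).sInf (fun _ h => h.m_lt.le)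
    (fun _ he _ hc => (EvaluablePred.lt hc (evaluable_input 1)).and
      (.eq (evaluable_clusterSum (hφ.mono he) (hj.mono he) hc)
        (evaluable_clusterMin (hφ.mono he) (hj.mono he) (evaluable_input 1))))
    fun _ _ _ hc => hc.1

theorem evaluablePred_isLeader (hφ : EvaluableFun Large d φ) (hc : Evaluable Large d c) :
    EvaluablePred Large d fun s => IsLeader s.input (φ s) (c s) :=
  .exists_lt (evaluable_input 2) (fun _ h => h.k_le) fun _ he _ hj =>
    .eq (evaluable_leader (hφ.mono he) hj) (hc.mono he)

theorem evaluable_leaderRank (hφ : EvaluableFun Large d φ) (hv : Evaluable Large d v) :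
    Evaluable Large d fun s => leaderRank s.input (φ s) (v s) :=
  ((evaluable_input 1).add (.const 1)).sInf (fun _ h => h.m_lt)
    (fun _ he _ hi => .exists_lt (evaluable_input 2) (fun _ h => h.k_le) fun _ he' _ hj =>
      .eq (evaluable_rk (hv.mono (he.trans he')) (evaluable_leader (hφ.mono (he.trans he')) hj))
        (hi.mono he'))
    fun _ _ _ ⟨_, _, hi⟩ => hi ▸ Nat.lt_succ_of_le (rk_le _ _ _)

theorem evaluable_markedSum (hψ : EvaluableFun Large d ψ) (hu : EvaluableFun Large d u)
    (hj : Evaluable Large d j) (hc : Evaluable Large d c) :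
    Evaluable Large d fun s => markedSum s.input (ψ s) (u s) (j s) (c s) :=
  (evaluable_input 0).sum_filter (fun _ h => h.n_lt.le)
    (fun e he _ hv => (EvaluablePred.eq (hψ e he _ hv) (hj.mono he)).and
      (.eq (hu e he _ hv) (.const 1)))
    fun _ he _ hv => evaluable_rk hv (hc.mono he)

theorem evaluablePred_allowed (hφ : EvaluableFun Large d φ) (hψ : EvaluableFun Large d ψ)
    (hu : EvaluableFun Large d u) (ht : EvaluableFun Large d t) (ha : Evaluable Large d a)
    (hj : Evaluable Large d j) (hc : Evaluable Large d c) :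
    EvaluablePred Large d fun s => Allowed s.input (φ s) (ψ s) (u s) (t s) (a s) (j s) (c s) :=
  ((EvaluablePred.eq hc ha).not.and (.le (evaluable_clusterSum hψ hj hc)
    ((evaluable_clusterMin hψ hj ha).add (ht d le_rfl _ hj)))).and
  (.forall_lt (evaluable_input 0) (fun _ h => h.n_lt.le) fun e he _ hv =>
    ((EvaluablePred.eq (hψ e he _ hv) (hj.mono he)).and (.eq (hu e he _ hv) (.const 1))).imp
      ((evaluablePred_isLeader (hφ.mono he) (hc.mono he)).not.and
        (.lt (evaluable_leaderRank (hφ.mono he) hv) (evaluable_rk hv (hc.mono he)))))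

theorem evaluable_markedMin (hφ : EvaluableFun Large d φ) (hψ : EvaluableFun Large d ψ)
    (hu : EvaluableFun Large d u) (ht : EvaluableFun Large d t) (ha : Evaluable Large d a)
    (hj : Evaluable Large d j) :
    Evaluable Large d fun s => markedMin s.input (φ s) (ψ s) (u s) (t s) (a s) (j s) :=
  (((evaluable_input 0).mul (evaluable_input 1) fun _ h => h.m_lt.le).add (.const 1)).sInf
    (fun _ h => h.mul_lt)
    (fun _ he _ hx => .exists_lt (evaluable_input 1) (fun _ h => h.m_lt.le) fun _ he' _ hc =>
      have he := he.trans he'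
      (evaluablePred_allowed (hφ.mono he) (hψ.mono he) (hu.mono he) (ht.mono he) (ha.mono he)
        (hj.mono he) hc).and
      (.eq (evaluable_markedSum (hψ.mono he) (hu.mono he) (hj.mono he) hc) (hx.mono he')))
    fun _ _ _ ⟨_, _, _, hx⟩ => hx ▸ Nat.lt_succ_of_le (sum_rk_le _ _ _)

theorem evaluablePred_overtakes (hφ : EvaluableFun Large d φ) (hψ : EvaluableFun Large d ψ)
    (hu : EvaluableFun Large d u) (ht : EvaluableFun Large d t) (ha : Evaluable Large d a) :
    EvaluablePred Large d fun s => Overtakes s.input (φ s) (ψ s) (u s) (t s) (a s) := by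
  have hmarked : ∀ e ≥ d, ∀ v, Evaluable Large e v →
      EvaluablePred Large e fun s => u s (v s) = 1 := fun e he v hv =>
    .eq (hu e he v hv) (.const 1)
  have hrank : ∀ e ≥ d, ∀ v, Evaluable Large e v →
      Evaluable Large e fun s => leaderRank s.input (φ s) (v s) := fun e he v hv =>
    evaluable_leaderRank (hφ.mono he) hv
  refine .and ?allowed (.and (.le ?markedCost ?markedGain) (.le ?cost ?gain))
  case allowed =>
    exact .forall_lt (evaluable_input 2) (fun _ h => h.k_le) fun e he _ hj =>
      .exists_lt (evaluable_input 1) (fun _ h => h.m_lt.le) fun e' he' _ hc =>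
        have he := he.trans he'
        evaluablePred_allowed (hφ.mono he) (hψ.mono he) (hu.mono he) (ht.mono he) (ha.mono he)
          (hj.mono he') hc
  case markedCost =>
    exact (evaluable_input 2).sum (fun _ h => h.k_le) fun e he _ hj =>
      evaluable_markedMin (hφ.mono he) (hψ.mono he) (hu.mono he) (ht.mono he) (ha.mono he) hj
  case markedGain =>
    exact (evaluable_input 3).add
      ((evaluable_input 0).sum_filter (fun _ h => h.n_lt.le) hmarked hrank)
  case cost =>
    exact (evaluable_input 2).sum (fun _ h => h.k_le) fun e he _ hj =>
      (evaluable_clusterMin (hψ.mono he) hj (ha.mono he)).add (ht e he _ hj)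
  case gain =>
    exact ((evaluable_input 3).add
      ((evaluable_input 0).card_filter (fun _ h => h.n_lt.le) hmarked)).add
      ((evaluable_input 0).sum (fun _ h => h.n_lt.le) hrank)

theorem evaluablePred_overtaken (hφ : EvaluableFun Large d φ) :
    EvaluablePred Large d fun s => Overtaken s.input (φ s) :=
  .exists_lt (evaluable_input 2) (fun _ h => h.k_le) fun _ h₁ _ hj =>
    evaluablePred_exists_guess fun _ h₂ _ hψ => (evaluablePred_clustering hψ).and <|
    evaluablePred_exists_guess fun _ h₃ _ hu => evaluablePred_exists_guess fun _ h₄ _ ht =>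
      have hφ := hφ.mono (h₁.trans (h₂.trans (h₃.trans h₄)))
      evaluablePred_overtakes hφ (hψ.mono (h₃.trans h₄)) (hu.mono h₄) ht
        (evaluable_leader hφ (hj.mono (h₂.trans (h₃.trans h₄))))

theorem evaluable_topCount (hc : Evaluable Large d c) :
    Evaluable Large d fun s => topCount s.input (c s) :=
  (evaluable_input 0).card_filter (fun _ h => h.n_lt.le) fun _ he _ hv =>
    .eq (evaluable_cand hv (.const 0)) (hc.mono he)

theorem evaluable_numTops : Evaluable Large d fun s => numTops s.input :=
  (evaluable_input 1).card_filter (fun _ h => h.m_lt.le) fun _ _ _ hc =>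
    .ne_zero (evaluable_topCount hc)

theorem evaluablePred_topsChange : EvaluablePred Large d fun s => TopsChange s.input :=
  .exists_lt (evaluable_input 1) (fun _ h => h.m_lt.le) fun _ _ _ hc =>
    ((EvaluablePred.eq_zero (evaluable_topCount hc)).and
      (.exists_lt (A := fun s v => rk s.input v _ ≤ s.input 3) (evaluable_input 0)
        (fun _ h => h.n_lt.le) fun _ he _ hv =>
          .le (evaluable_rk hv (hc.mono he)) (evaluable_input 3))).or
    ((EvaluablePred.ne_zero (evaluable_topCount hc)).and
      (.le (evaluable_topCount hc) (evaluable_input 3)))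

end Large

theorem evaluablePred_answer {d : ℕ} :
    EvaluablePred (fun w b => w 0 * w 1 < b ∧ (w 0 + 1) ^ w 0 ≤ b) d fun s => Answer s.input := by
  have hw : ∀ x, Evaluable (fun w b => w 0 * w 1 < b ∧ (w 0 + 1) ^ w 0 ≤ b) d
      fun s => s.input x := fun x => (Evaluable.const x).input
  refine EvaluablePred.and_of (P' := Large) (((EvaluablePred.lt (.const 0) (hw 0)).and
    (.lt (.const 0) (hw 2))).and ((EvaluablePred.lt (hw 2) (hw 1)).and (.lt (.const 0) (hw 3)))) ?_
    fun s ⟨hmul, hpow⟩ ⟨⟨hn, _⟩, hk, _⟩ => ?_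
  · exact ((EvaluablePred.lt Large.evaluable_numTops (Large.evaluable_input 2)).and
      Large.evaluablePred_topsChange).or
      ((EvaluablePred.le (Large.evaluable_input 2) Large.evaluable_numTops).and
      (Large.evaluablePred_exists_guess fun _ _ _ hφ =>
        (Large.evaluablePred_optimal hφ).and (Large.evaluablePred_overtaken hφ)))
  · have hm : s.input 1 < s.bound := (Nat.le_mul_of_pos_left _ hn).trans_lt hmul
    exact ⟨(Nat.lt_succ_self _).trans_le ((Nat.le_self_pow hn.ne' _).trans hpow), hm,
      (hk.trans hm).le, hmul, hpow⟩

/-! ### Correctness of the algorithm -/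

section Correctness

variable {w φ ψ u t c : ℕ → ℕ} {E : Election (w 1) (w 0)} {T : Finset (Fin (w 1))}
  {rep : Fin (w 0) → Fin (w 1)} {U : Finset (Fin (w 0))} {s : Fin (w 1)} {a j : ℕ}

/-- The sequence `w` lists the votes of `E` in the format that is read by `cand`. -/
def Lists (w : ℕ → ℕ) (E : Election (w 1) (w 0)) : Prop :=
  ∀ (v : Fin (w 0)) (i : Fin (w 1)), cand w v i = E v i

namespace Lists

theorem cand_eq_iff (hE : Lists w E) (v : Fin (w 0)) (d : Fin (w 1)) {i : ℕ} (hi : i < w 1) :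
    cand w v i = d ↔ rank (E v) d = i := by
  rw [hE v ⟨i, hi⟩, Fin.val_inj, eq_comm, ← Equiv.symm_apply_eq, ← Fin.val_inj, rank]

theorem rk_eq (hE : Lists w E) (v : Fin (w 0)) (d : Fin (w 1)) : rk w v d = rank (E v) d := by
  have hset : {i | i < w 1 ∧ cand w v i = d} = {rank (E v) d} := Set.ext fun i =>
    ⟨fun h => ((hE.cand_eq_iff v d h.1).1 h.2).symm, fun h =>
      h ▸ ⟨rank_lt _ _, (hE.cand_eq_iff v d (rank_lt _ _)).2 rfl⟩⟩
  rw [rk, hset, csInf_singleton]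

end Lists

theorem filter_range_eq_map {n : ℕ} {P : ℕ → Prop} [DecidablePred P] {V : Finset (Fin n)}
    (h : ∀ v : Fin n, P v ↔ v ∈ V) : {v ∈ range n | P v} = V.map Fin.valEmbedding := by
  ext v
  simp only [mem_filter, mem_range, mem_map, Fin.valEmbedding_apply]
  exact ⟨fun ⟨hv, hP⟩ => ⟨⟨v, hv⟩, (h _).1 hP, rfl⟩, fun ⟨i, hi, hv⟩ => hv ▸ ⟨i.2, (h i).2 hi⟩⟩

theorem card_le_of_forall_exists_eq {m k : ℕ} {S : Finset (Fin m)} (f : ℕ → ℕ)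
    (h : ∀ x ∈ S, ∃ j < k, f j = x) : #S ≤ k :=
  calc #S
    _ = #(S.map Fin.valEmbedding) := (card_map _).symm
    _ ≤ #((range k).image f) := card_le_card fun x hx => by
      obtain ⟨y, hy, rfl⟩ := mem_map.1 hx
      obtain ⟨j, hj, hf⟩ := h y hy
      exact mem_image.2 ⟨j, mem_range.2 hj, hf⟩
    _ ≤ k := card_image_le.trans_eq (card_range k)

theorem sum_fiberwise_apply {ι κ : Type*} [DecidableEq κ] {I : Finset ι} {K : Finset κ} {g : ι → κ}
    (h : ∀ i ∈ I, g i ∈ K) (f : κ → ι → ℕ) :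
    ∑ j ∈ K, ∑ i ∈ I with g i = j, f j i = ∑ i ∈ I, f (g i) i := by
  rw [← sum_fiberwise_of_maps_to h]
  exact sum_congr rfl fun j _ => sum_congr rfl fun i hi => by rw [(mem_filter.1 hi).2]

namespace Lists

theorem topCount_eq (hE : Lists w E) (d : Fin (w 1)) : topCount w d = #{v | rank (E v) d = 0} := by
  rw [topCount, filter_range_eq_map (V := {v | rank (E v) d = 0}) fun v => ?_, card_map]
  rw [mem_filter_univ, hE.cand_eq_iff v d d.pos]

theorem topCount_ne_zero_iff (hE : Lists w E) (d : Fin (w 1)) :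
    topCount w d ≠ 0 ↔ d ∈ tops E := by
  rw [hE.topCount_eq, card_ne_zero, filter_nonempty_iff, mem_tops]
  simp only [mem_univ, true_and]

theorem numTops_eq (hE : Lists w E) : numTops w = #(tops E) := by
  rw [numTops, filter_range_eq_map hE.topCount_ne_zero_iff, card_map]

theorem topsChange_iff (hE : Lists w E) : TopsChange w ↔
    ∃ d, (d ∉ tops E ∧ ∃ v, rank (E v) d ≤ w 3) ∨
      (d ∈ tops E ∧ #{v | rank (E v) d = 0} ≤ w 3) := by
  rw [TopsChange, Fin.exists_iff]
  refine exists_congr fun x => (exists_prop.symm.trans (exists_congr fun hx => or_congr ?_ ?_))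
  · rw [← hE.topCount_ne_zero_iff, not_not, Fin.exists_iff]
    refine and_congr_right fun _ => exists_congr fun v =>
      (exists_prop.symm.trans (exists_congr fun hv => ?_))
    rw [← hE.rk_eq]
  · rw [← hE.topCount_ne_zero_iff, ← hE.topCount_eq]

end Lists

theorem exists_clusterSum_eq (h : ∃ x < w 1, x ≠ a) :
    ∃ x < w 1, x ≠ a ∧ clusterSum w φ j x = clusterMin w φ j a :=
  have ⟨x, hx, hxa⟩ := h
  Nat.sInf_mem (s := {y | ∃ x < w 1, x ≠ a ∧ clusterSum w φ j x = y}) ⟨_, x, hx, hxa, rfl⟩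

theorem clusterMin_le {x : ℕ} (hx : x < w 1) (hxa : x ≠ a) :
    clusterMin w φ j a ≤ clusterSum w φ j x :=
  Nat.sInf_le ⟨x, hx, hxa, rfl⟩

theorem exists_markedSum_eq (h : ∃ x < w 1, Allowed w φ ψ u t a j x) :
    ∃ x < w 1, Allowed w φ ψ u t a j x ∧ markedSum w ψ u j x = markedMin w φ ψ u t a j :=
  have ⟨x, hx, hxa⟩ := h
  Nat.sInf_mem (s := {y | ∃ x < w 1, Allowed w φ ψ u t a j x ∧ markedSum w ψ u j x = y})
    ⟨_, x, hx, hxa, rfl⟩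

theorem markedMin_le {x : ℕ} (hx : x < w 1) (hxa : Allowed w φ ψ u t a j x) :
    markedMin w φ ψ u t a j ≤ markedSum w ψ u j x :=
  Nat.sInf_le ⟨x, hx, hxa, rfl⟩

theorem leader_spec (hm : 0 < w 1) (φ : ℕ → ℕ) (j : ℕ) :
    leader w φ j < w 1 ∧ clusterSum w φ j (leader w φ j) = clusterMin w φ j (w 1) :=
  have ⟨x, hx, _, hmin⟩ := exists_clusterSum_eq (w := w) ⟨0, hm, hm.ne⟩
  Nat.sInf_mem (s := {x | x < w 1 ∧ clusterSum w φ j x = clusterMin w φ j (w 1)}) ⟨x, hx, hmin⟩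

open Classical in
/-- The committee of the leaders of `φ`. -/
noncomputable def leaders (w φ : ℕ → ℕ) : Finset (Fin (w 1)) := {d | IsLeader w φ d}

theorem mem_leaders {d : Fin (w 1)} : d ∈ leaders w φ ↔ IsLeader w φ d := by
  simp only [leaders, mem_filter, mem_univ, true_and]

theorem card_leaders_le (w φ : ℕ → ℕ) : #(leaders w φ) ≤ w 2 :=
  card_le_of_forall_exists_eq (leader w φ) fun _ => mem_leaders.1

theorem leaders_nonempty (hm : 0 < w 1) (hk : 0 < w 2) (φ : ℕ → ℕ) : (leaders w φ).Nonempty :=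
  ⟨⟨leader w φ 0, (leader_spec hm φ 0).1⟩, mem_leaders.2 ⟨0, hk, rfl⟩⟩

theorem sum_leaderRank_le_clusterCost (hm : 0 < w 1) (hφ : Clustering w φ) :
    ∑ v ∈ range (w 0), leaderRank w φ v ≤ clusterCost w φ :=
  calc ∑ v ∈ range (w 0), leaderRank w φ v
    _ ≤ ∑ v ∈ range (w 0), rk w v (leader w φ (φ v)) :=
      sum_le_sum fun v hv => Nat.sInf_le ⟨φ v, hφ v (mem_range.1 hv), rfl⟩
    _ = ∑ j ∈ range (w 2), clusterSum w φ j (leader w φ j) :=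
      (sum_fiberwise_apply (fun v hv => mem_range.2 (hφ v (mem_range.1 hv)))
        fun j v => rk w v (leader w φ j)).symm
    _ = clusterCost w φ := sum_congr rfl fun j _ => (leader_spec hm φ j).2

namespace Lists

theorem leaderRank_eq (hE : Lists w E) (hm : 0 < w 1) (φ : ℕ → ℕ) (v : Fin (w 0)) :
    leaderRank w φ v = bestRank (E v) (leaders w φ) := by
  refine congrArg sInf (Set.ext fun i => ⟨?_, ?_⟩)
  · rintro ⟨j, hj, rfl⟩
    have hlt := (leader_spec hm φ j).1
    exact ⟨⟨leader w φ j, hlt⟩, mem_leaders.2 ⟨j, hj, rfl⟩, (hE.rk_eq v ⟨_, hlt⟩).symm⟩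
  · rintro ⟨d, hd, rfl⟩
    obtain ⟨j, hj, hjd⟩ := mem_leaders.1 hd
    exact ⟨j, hj, by rw [hjd, hE.rk_eq]⟩

theorem sum_leaderRank_eq (hE : Lists w E) (hm : 0 < w 1) (φ : ℕ → ℕ) :
    ∑ v ∈ range (w 0), leaderRank w φ v = rankCost E (leaders w φ) :=
  (sum_range _).trans (sum_congr rfl fun v _ => hE.leaderRank_eq hm φ v)

theorem sum_clusterSum_eq (hE : Lists w E) (hψ : Clustering w ψ)
    (hc : ∀ v : Fin (w 0), c (ψ v) = rep v) :
    ∑ j ∈ range (w 2), clusterSum w ψ j (c j) = ∑ v, rank (E v) (rep v) :=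
  calc ∑ j ∈ range (w 2), clusterSum w ψ j (c j)
    _ = ∑ v ∈ range (w 0), rk w v (c (ψ v)) :=
      sum_fiberwise_apply (fun v hv => mem_range.2 (hψ v (mem_range.1 hv))) fun j v => rk w v (c j)
    _ = ∑ v : Fin (w 0), rk w v (c (ψ v)) := sum_range _
    _ = ∑ v, rank (E v) (rep v) := sum_congr rfl fun v _ => by rw [hc, hE.rk_eq]

theorem sum_markedSum_eq (hE : Lists w E) (hψ : Clustering w ψ)
    (hc : ∀ v : Fin (w 0), c (ψ v) = rep v) (hu : ∀ v : Fin (w 0), u v = 1 ↔ v ∈ U) :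
    ∑ j ∈ range (w 2), markedSum w ψ u j (c j) = ∑ v ∈ U, rank (E v) (rep v) :=
  calc ∑ j ∈ range (w 2), markedSum w ψ u j (c j)
    _ = ∑ j ∈ range (w 2), ∑ v ∈ {v ∈ range (w 0) | u v = 1} with ψ v = j, rk w v (c j) := by
      simp only [markedSum, filter_filter, and_comm]
    _ = ∑ v ∈ range (w 0) with u v = 1, rk w v (c (ψ v)) :=
      sum_fiberwise_apply (fun v hv => mem_range.2 (hψ v (mem_range.1 (mem_filter.1 hv).1)))
        fun j v => rk w v (c j)
    _ = ∑ v ∈ U, rank (E v) (rep v) := by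
      rw [filter_range_eq_map hu, sum_map]
      exact sum_congr rfl fun v _ => by rw [Fin.valEmbedding_apply, hc, hE.rk_eq]

end Lists

theorem exists_guess_eq {n : ℕ} {p : Fin n → ℕ} (hp : ∀ v, p v ≤ n) :
    ∃ f ∈ guesses n, ∀ v : Fin n, f v = p v := by
  refine ⟨fun v => if hv : v < n then p ⟨v, hv⟩ else 0, ⟨fun v => ?_, fun v hv => ?_⟩, fun v => ?_⟩
  · dsimp only
    split_ifs with hv
    · exact hp _
    · exact Nat.zero_le _
  · exact dif_neg hv.not_gt
  · exact dif_pos v.2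

theorem exists_guess_add_eq {n k : ℕ} {f g : ℕ → ℕ} (hk : k ≤ n) (hfg : ∀ j < k, f j ≤ g j)
    (hsum : ∑ j ∈ range k, g j ≤ n + ∑ j ∈ range k, f j) :
    ∃ t ∈ guesses n, ∀ j < k, f j + t j = g j := by
  have hle : ∀ j < k, g j - f j ≤ n := fun j hj =>
    calc g j - f j
      _ ≤ ∑ j ∈ range k, (g j - f j) :=
        single_le_sum (f := fun j => g j - f j) (fun _ _ => Nat.zero_le _) (mem_range.2 hj)
      _ = ∑ j ∈ range k, g j - ∑ j ∈ range k, f j :=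
        sum_tsub_distrib _ fun j hj => hfg j (mem_range.1 hj)
      _ ≤ n := Nat.sub_le_iff_le_add.2 hsum
  obtain ⟨t, ht, heq⟩ := exists_guess_eq (n := n) (p := fun j => if j < k then g j - f j else 0)
    fun j => by
      split_ifs with hj
      · exact hle j hj
      · exact Nat.zero_le _
  refine ⟨t, ht, fun j hj => ?_⟩
  rw [heq ⟨j, hj.trans_le hk⟩, if_pos hj, Nat.add_sub_cancel' (hfg j hj)]

theorem exists_clustering (hn : 0 < w 0) (hk : w 2 ≤ w 0) (hrep : #(univ.image rep) ≤ w 2) :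
    ∃ ψ ∈ guesses (w 0), Clustering w ψ ∧ ∃ c : ℕ → ℕ,
      (∀ j, ∃ v, c j = rep v) ∧ ∀ v : Fin (w 0), c (ψ v) = rep v := by
  have : Nonempty (Fin (w 0)) := ⟨⟨0, hn⟩⟩
  let p : Fin (w 0) → ℕ := fun v =>
    (univ.image rep).equivFin ⟨rep v, mem_image_of_mem rep (mem_univ v)⟩
  have hp : ∀ v, p v < w 2 := fun v => (Fin.is_lt _).trans_le hrep
  have hrep_eq : ∀ {v v'}, p v = p v' → rep v = rep v' := fun h =>
    congrArg Subtype.val ((univ.image rep).equivFin.injective (Fin.val_injective h))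
  obtain ⟨ψ, hψ, hψp⟩ := exists_guess_eq fun v => (hp v).le.trans hk
  refine ⟨ψ, hψ, fun v hv => ?_, fun j => rep (Function.invFun p j), fun j => ⟨_, rfl⟩,
    fun v => ?_⟩
  · rw [hψp ⟨v, hv⟩]
    exact hp _
  · rw [hψp v]
    exact congrArg Fin.val (hrep_eq (Function.invFun_eq ⟨v, rfl⟩))

theorem exists_optimal (hk : 0 < w 2) : ∃ φ ∈ guesses (w 0), Optimal w φ := by
  have hne : {φ ∈ guesses (w 0) | Clustering w φ}.Nonempty :=
    ⟨0, ⟨fun _ => Nat.zero_le _, fun _ _ => rfl⟩, fun _ _ => hk⟩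
  obtain ⟨φ, ⟨hφ, hclus⟩, hmin⟩ := exists_minimalFor_of_wellFoundedLT _ (clusterCost w) hne
  exact ⟨φ, hφ, hclus, fun φ' hφ' hclus' =>
    le_of_not_gt fun hlt => hlt.not_ge (hmin ⟨hφ', hclus'⟩ hlt.le)⟩

theorem overtakes_of_allowed (hc : ∀ j < w 2, c j < w 1 ∧ Allowed w φ ψ u t a j (c j))
    (hmarked : ∑ j ∈ range (w 2), markedSum w ψ u j (c j) ≤
      w 3 + ∑ v ∈ range (w 0) with u v = 1, leaderRank w φ v)
    (htotal : ∑ j ∈ range (w 2), (clusterMin w ψ j a + t j) ≤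
      w 3 + #{v ∈ range (w 0) | u v = 1} + ∑ v ∈ range (w 0), leaderRank w φ v) :
    Overtakes w φ ψ u t a :=
  ⟨fun j hj => ⟨c j, hc j hj⟩, (sum_le_sum fun j hj =>
    markedMin_le (hc j (mem_range.1 hj)).1 (hc j (mem_range.1 hj)).2).trans hmarked,
    htotal⟩

theorem overtakes_of_sum_clusterMin_le (h : ∃ x < w 1, x ≠ a)
    (hsum : ∑ j ∈ range (w 2), clusterMin w ψ j a ≤
      w 3 + ∑ v ∈ range (w 0), leaderRank w φ v) : Overtakes w φ ψ 0 0 a := by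
  choose c hc hca hmin using fun j => exists_clusterSum_eq (φ := ψ) (j := j) h
  refine overtakes_of_allowed (c := c) (fun j _ => ⟨hc j, ⟨hca j, (hmin j).le⟩, ?_⟩) ?_ ?_
  · exact fun v _ hv => absurd hv.2 zero_ne_one
  · simp only [markedSum, Pi.zero_apply, zero_ne_one, and_false, filter_false, sum_empty,
      sum_const_zero, Nat.zero_le]
  · simpa only [Pi.zero_apply, zero_ne_one, filter_false, card_empty, add_zero] using hsum

namespace Lists

theorem exists_clusterCost_le (hE : Lists w E) (hk : 0 < w 2) (hkn : w 2 ≤ w 0)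
    (hT : #T = w 2) : ∃ φ ∈ guesses (w 0), Clustering w φ ∧ clusterCost w φ ≤ rankCost E T := by
  obtain ⟨rep, hrep, hcost⟩ := exists_sum_rank_eq_rankCost E (card_pos.1 (hk.trans_eq hT.symm))
  obtain ⟨φ, hφ, hclus, c, hc, hcφ⟩ :=
    exists_clustering (hk.trans_le hkn) hkn (hT ▸ card_image_rep_le hrep)
  refine ⟨φ, hφ, hclus, ?_⟩
  rw [← hcost, ← hE.sum_clusterSum_eq hclus hcφ]
  refine sum_le_sum fun j _ => ?_
  obtain ⟨v, hv⟩ := hc j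
  have hlt : c j < w 1 := hv ▸ (rep v).2
  exact clusterMin_le hlt hlt.ne

theorem leaders_mem_betaCC (hE : Lists w E) (hk : 0 < w 2) (htops : w 2 ≤ #(tops E))
    (hφ : Optimal w φ) :
    leaders w φ ∈ betaCC (w 1) (w 0) E (w 2) := by
  have hkm : w 2 ≤ w 1 := htops.trans (card_finset_fin_le _)
  have hm : 0 < w 1 := hk.trans_le hkm
  have hkn : w 2 ≤ w 0 := htops.trans (card_tops_le hm E)
  have hopt : ∀ T, #T = w 2 → rankCost E (leaders w φ) ≤ rankCost E T := by
    intro T hT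
    obtain ⟨φ', hφ', hclus, hcost⟩ := hE.exists_clusterCost_le hk hkn hT
    rw [← hE.sum_leaderRank_eq hm]
    exact (sum_leaderRank_le_clusterCost hm hφ.1).trans ((hφ.2 φ' hφ' hclus).trans hcost)
  refine (mem_betaCC_iff hk).2 ⟨(card_leaders_le w φ).antisymm (le_of_not_gt fun hlt => ?_), hopt⟩
  have hsub := tops_subset_of_forall_rankCost_le hkm (leaders_nonempty hm hk φ) hlt hopt
  exact hlt.not_ge (htops.trans (card_le_card hsub))

theorem exists_overtaking (hE : Lists w E) (hm : 0 < w 1) (h : Overtaken w φ) :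
    ∃ rep U s, Overtaking E (w 2) (w 3) (leaders w φ) rep U s := by
  obtain ⟨i, hi, ψ, -, hψ, u, -, t, -, hallowed, hmarked, htotal⟩ := h
  choose! c hc hcallowed hmin using fun j hj => exists_markedSum_eq (hallowed j hj)
  let rep : Fin (w 0) → Fin (w 1) := fun v => ⟨c (ψ v), hc _ (hψ v v.2)⟩
  let U : Finset (Fin (w 0)) := {v | u v = 1}
  have hU : ∀ v : Fin (w 0), u v = 1 ↔ v ∈ U := fun v => by
    rw [mem_filter_univ]
  have hsumU : ∀ f : ℕ → ℕ, ∑ v ∈ range (w 0) with u v = 1, f v = ∑ v ∈ U, f v := fun f => by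
    rw [filter_range_eq_map hU, sum_map]
    rfl
  refine ⟨rep, U, ⟨leader w φ i, (leader_spec hm φ i).1⟩, ?mem, ?card_le, ?ne, ?below, ?marked_le,
    ?total_le⟩
  case mem => exact mem_leaders.2 ⟨i, hi, rfl⟩
  case card_le =>
    refine card_le_of_forall_exists_eq c fun x hx => ?_
    obtain ⟨v, -, rfl⟩ := mem_image.1 hx
    exact ⟨ψ v, hψ v v.2, rfl⟩
  case ne => exact fun v h => (hcallowed _ (hψ v v.2)).1.1 (congrArg Fin.val h)
  case below =>
    intro v hv
    have h := (hcallowed _ (hψ v v.2)).2 v v.2 ⟨rfl, (hU v).2 hv⟩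
    rw [← mem_leaders (d := rep v), hE.leaderRank_eq hm, hE.rk_eq v (rep v)] at h
    exact h
  case marked_le =>
    rw [← hE.sum_markedSum_eq hψ (fun _ => rfl) hU,
      sum_congr rfl fun j hj => hmin j (mem_range.1 hj)]
    simpa only [hsumU, hE.leaderRank_eq hm] using hmarked
  case total_le =>
    rw [← hE.sum_clusterSum_eq hψ (c := c) (fun _ => rfl), ← hE.sum_leaderRank_eq hm]
    rw [filter_range_eq_map hU, card_map] at htotal
    exact (sum_le_sum fun j hj => (hcallowed j (mem_range.1 hj)).1.2).trans htotal

theorem overtaken (hE : Lists w E) (hkn : w 2 ≤ w 0)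
    (h : Overtaking E (w 2) (w 3) (leaders w φ) rep U s) : Overtaken w φ := by
  have hm : 0 < w 1 := s.pos
  obtain ⟨i, hi, hs⟩ := mem_leaders.1 h.mem
  obtain ⟨ψ, hψ, hclus, c, hc, hcψ⟩ := exists_clustering (by omega) hkn h.card_le
  have hclt : ∀ j, c j < w 1 := fun j => (hc j).elim fun v hv => hv ▸ (rep v).2
  have hcne : ∀ j, c j ≠ s := fun j => (hc j).elim fun v hv =>
    hv ▸ fun heq => h.ne v (Fin.val_injective heq)
  refine ⟨i, hi, ψ, hψ, hclus, ?_⟩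
  rw [hs]
  rcases le_or_gt (∑ j ∈ range (w 2), clusterMin w ψ j s)
    (w 3 + ∑ v ∈ range (w 0), leaderRank w φ v) with hsum | hsum
  · have hzero : (0 : ℕ → ℕ) ∈ guesses (w 0) := ⟨fun _ => Nat.zero_le _, fun _ _ => rfl⟩
    exact ⟨0, hzero, 0, hzero, overtakes_of_sum_clusterMin_le ⟨c 0, hclt 0, hcne 0⟩ hsum⟩
  · obtain ⟨u, hu, hindicator⟩ := exists_guess_eq (n := w 0)
      (p := fun v => if v ∈ U then 1 else 0) fun v => by split_ifs <;> omega
    have hU : ∀ v : Fin (w 0), u v = 1 ↔ v ∈ U := fun v => by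
      rw [hindicator, ite_eq_left_iff, imp_iff_not zero_ne_one, not_not]
    have htotal := h.total_le
    rw [← hE.sum_clusterSum_eq hclus hcψ, ← hE.sum_leaderRank_eq hm] at htotal
    obtain ⟨t, ht, hexcess⟩ := exists_guess_add_eq (f := (clusterMin w ψ · s))
      (g := fun j => clusterSum w ψ j (c j)) hkn (fun j _ => clusterMin_le (hclt j) (hcne j)) (by
        have := card_finset_fin_le U
        omega)
    refine ⟨u, hu, t, ht, overtakes_of_allowed (c := c)
      (fun j hj => ⟨hclt j, ⟨hcne j, (hexcess j hj).ge⟩, ?_⟩) ?_ ?_⟩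
    · rintro v hv ⟨rfl, huv⟩
      have hbelow := h.below _ ((hU ⟨v, hv⟩).1 huv)
      rw [mem_leaders, ← hE.leaderRank_eq hm, ← hE.rk_eq, ← hcψ] at hbelow
      exact hbelow
    · rw [hE.sum_markedSum_eq hclus hcψ hU, filter_range_eq_map hU, sum_map]
      simpa only [Fin.valEmbedding_apply, hE.leaderRank_eq hm] using h.marked_le
    · rw [sum_congr rfl fun j hj => hexcess j (mem_range.1 hj), filter_range_eq_map hU, card_map]
      exact htotal

end Lists

theorem pos_of_robustnessRadius {m n k B : ℕ} {E : Election m n}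
    (h : RobustnessRadius betaCC ⟨m, n, E, k, B⟩) : (0 < n ∧ 0 < k) ∧ k < m ∧ 0 < B := by
  obtain ⟨E', hreach, hne⟩ := h
  have hdegenerate : ¬(k = 0 ∨ m ≤ k) := fun hk =>
    hne ((betaCC_eq_setOf_card_eq E' hk).trans (betaCC_eq_setOf_card_eq E hk).symm)
  have hEE' : E' ≠ E := fun h => hne (h ▸ rfl)
  refine ⟨⟨Nat.pos_of_ne_zero ?_, by omega⟩, by omega, Nat.pos_of_ne_zero ?_⟩
  · rintro rfl
    exact hEE' (Subsingleton.elim _ _)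
  · rintro rfl
    exact hEE' hreach.eq_of_zero

theorem Lists.answer_iff (hE : Lists w E) :
    Answer w ↔ RobustnessRadius betaCC ⟨w 1, w 0, E, w 2, w 3⟩ := by
  refine (and_congr_right fun ⟨⟨_, hk⟩, hkm, hB⟩ => ?_).trans
    (and_iff_right_of_imp pos_of_robustnessRadius)
  have hm : 0 < w 1 := hk.trans hkm
  rw [hE.numTops_eq]
  rcases lt_or_ge #(tops E) (w 2) with htops | htops
  · rw [robustnessRadius_iff_of_card_tops_lt hkm htops, ← hE.topsChange_iff]
    simp only [htops, htops.not_ge, true_and, false_and, or_false]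
  · have hkn : w 2 ≤ w 0 := htops.trans (card_tops_le hm E)
    have hiff : ∀ φ, Optimal w φ →
        (Overtaken w φ ↔ RobustnessRadius betaCC ⟨w 1, w 0, E, w 2, w 3⟩) := fun φ hφ => by
      rw [robustnessRadius_iff_exists_overtaking hk hkm hB htops
        (hE.leaders_mem_betaCC hk htops hφ)]
      exact ⟨hE.exists_overtaking hm, fun ⟨_, _, _, h⟩ => hE.overtaken hkn h⟩
    simp only [htops, htops.not_gt, true_and, false_and, false_or]
    refine ⟨fun ⟨φ, _, hφ, h⟩ => (hiff φ hφ).1 h, fun h => ?_⟩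
    obtain ⟨φ, hφ, hopt⟩ := exists_optimal hk
    exact ⟨φ, hφ, hopt, (hiff φ hopt).2 h⟩

end Correctness

/-! ### Encodings of instances -/

theorem getD_flatten_of_length_eq {α : Type*} {m : ℕ} {l : List (List α)}
    (hl : ∀ x ∈ l, x.length = m) {v i : ℕ} (hv : v < l.length) (hi : i < m) (d : α) :
    l.flatten.getD (v * m + i) d = l[v].getD i d := by
  induction l generalizing v with
  | nil => exact absurd hv (Nat.not_lt_zero v)
  | cons x l ih =>
    have hx : x.length = m := hl x List.mem_cons_self
    rw [List.flatten_cons]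
    cases v with
    | zero => rw [zero_mul, zero_add, List.getD_append _ _ _ _ (hx ▸ hi), List.getElem_cons_zero]
    | succ v =>
      have hindex : (v + 1) * m + i = x.length + (v * m + i) := by
        rw [hx]
        ring
      rw [hindex, List.getD_append_right _ _ _ _ (Nat.le_add_right _ _), Nat.add_sub_cancel_left,
        List.getElem_cons_succ]
      exact ih (fun y hy => hl y (List.mem_cons_of_mem x hy)) (Nat.lt_of_succ_lt_succ hv)

theorem Instance.length_encode (I : Instance) : I.encode.length = 4 + I.n * I.m := by
  simp only [Instance.encode, List.length_append, List.length_flatMap, List.length_ofFn,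
    List.map_const', List.length_finRange, List.sum_replicate, smul_eq_mul]
  rfl

theorem Instance.getD_encode (I : Instance) (v : Fin I.n) (i : Fin I.m) :
    I.encode.getD (4 + v * I.m + i) 0 = I.election v i := by
  have h := getD_flatten_of_length_eq (m := I.m) (l := (List.finRange I.n).map fun v =>
    List.ofFn fun i : Fin I.m => (I.election v i : ℕ)) (by simp) (v := v) (by simp) i.2 0
  rw [Instance.encode, add_assoc, List.getD_append_right _ _ _ _ (Nat.le_add_right 4 _),
    List.flatMap_def]
  change List.getD _ (4 + (v * I.m + i) - 4) 0 = _
  rw [Nat.add_sub_cancel_left]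
  exact h.trans (by simp)

theorem Instance.lists (I : Instance) : Lists (I.encode.getD · 0) I.election :=
  I.getD_encode

end RobustCC

theorem mainTheorem11 :
    (RobustCC.robustnessRadiusByVoters RobustCC.betaCC).InFPT := by
  refine RobustCC.inFPT_of_evaluablePred _ (g := fun n => (n + 1) ^ n)
    ((Primrec₂.unpaired'.1 Nat.Primrec.pow).comp Primrec.succ .id)
    ?_ RobustCC.evaluablePred_answer (fun I => List.cons_ne_nil _ _) (fun _ => rfl)
    (fun I b hb => ?_) fun I => I.lists.answer_iff
  · exact .pow_succ_self (RobustCC.Evaluable.const 0).input fun _ h => h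
  · change I.encode.length + (I.n + 1) ^ I.n ≤ b at hb
    rw [I.length_encode] at hb
    change I.n * I.m < b ∧ (I.n + 1) ^ I.n ≤ b
    lia
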